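/- Fix a vocabulary consisting of one binary relation symbol $R$ and a countably infinite set of proposition letters. A \emph{tree model} is a Kripke model $T=(W,R,V)$ whose frame $(W,R)$ is a (possibly infinite) directed tree with a unique root: the root has no parent, every node is reachable from the root in finitely many steps, and no node has two parents. A \emph{pointed tree model} is a pair $(T,n)$ with $n$ any node of $T$. For a node $n$ and a proposition letter $p$ true at $n$, let $\mathrm{Subtree}(T,n,p)$ be the largest subtree of $T$ that contains $n$ and contains only nodes satisfying $p$ ($n$ need not be its root). An \emph{abstract modal logic (on trees)} is a set $\mathcal L$ of formulas with a truth relation $\models$ between formulas and pointed tree models such that truth is invariant under isomorphism and $\mathcal L$ is closed under (i) negation and conjunction; (ii) renaming: for every map $\rho$ from proposition letters to proposition letters and every $\varphi\in\mathcal L$ there is $\psi\in\mathcal L$ with $(T,n)\models\psi$ iff $(\rho(T),n)\models\varphi$, for all $(T,n)$, where $\rho(T)$ is $T$ with $p$ interpreted as $V(\rho(p))$; (iii) relativisation on trees: for every $\varphi\in\mathcal L$ and letter $p$ there is $\psi\in\mathcal L$ such that, for all $(T,n)$, $(T,n)\models\psi$ iff $(T,n)\models p$ and $(\mathrm{Subtree}(T,n,p),n)\models\varphi$.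 $\mathcal L$ is \emph{closed under substitution} if for all $\varphi,\psi\in\mathcal L$ and every letter $p$ there is $\chi\in\mathcal L$ such that, for all $(T,n)$, $(T,n)\models\chi$ iff $(T^{[p\mapsto\{v\,\mid\,(T,v)\models\psi\}]},n)\models\varphi$, where $T^{[p\mapsto S]}$ is $T$ with the valuation of $p$ changed to $S$. \emph{Graded modal logic} ($GML$) is propositional logic over the proposition letters together with the modalities $\Diamond_k\varphi$ ($k\in\mathbb N$): at least $k$ successors of the current node satisfy $\varphi$. A logic $\mathcal L'$ \emph{extends} $\mathcal L$ on trees (equivalently, $\mathcal L$ is \emph{no more expressive than} $\mathcal L'$ on trees) if there is a map from $\mathcal L$-formulas to $\mathcal L'$-formulas that preserves truth in all pointed tree models. $\mathcal L$ has \emph{Compactness on trees} if every set of $\mathcal L$-formulas all of whose finite subsets are true in some pointed tree model is itself true in some pointed tree model; it has the \emph{Löwenheim--Skolem property on trees} if every set of $\mathcal L$-formulas that is true in some pointed tree model is true in some countable pointed tree model. It is \emph{invariant for generated submodels} if $(T,n)\models\varphi$ iff $(T_n,n)\models\varphi$ for all $\varphi\in\mathcal L$ and all $(T,n)$, where $T_n$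 is the submodel of the nodes reachable from $n$ in finitely many steps. \textbf{Theorem.} Let $\mathcal L$ be an abstract modal logic that is closed under substitution and extends $GML$ on trees. Then $\mathcal L$ has Compactness and the Löwenheim--Skolem property on trees if and only if $\mathcal L$ is no more expressive than $GML$ on trees. Moreover, if $\mathcal L$ has Compactness and the Löwenheim--Skolem property on trees, then $\mathcal L$ is invariant for generated submodels. -/

import Mathlib

universe u v w

namespace GMLTrees

/-- The proposition letters: a fixed countably infinite set. -/
abbrev PropLetter : Type := ℕ

/-- `R` is the (directed, possibly infinite) edge relation of a tree: there is a root, which has no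
parent; every node is reachable from it in finitely many steps; no node has two parents. -/
def IsTree {W : Type u} (R : W → W → Prop) : Prop :=
  ∃ r : W, (∀ x, ¬ R x r) ∧ (∀ x, Relation.ReflTransGen R r x) ∧
    ∀ x y z, R x z → R y z → x = y

/-- A tree model: a Kripke model whose underlying frame is a tree. -/
structure TreeModel where
  /-- the set of nodes -/
  W : Type u
  /-- the accessibility relation, from parent to child -/
  R : W → W → Prop
  /-- the valuation of the proposition letters -/
  V : PropLetter → Set W
  isTree : IsTree R

namespace TreeModel

/-- An isomorphism of tree models. -/
structure Iso (T T' : TreeModel.{u}) where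
  toEquiv : T.W ≃ T'.W
  map_R : ∀ x y, T.R x y ↔ T'.R (toEquiv x) (toEquiv y)
  map_V : ∀ p x, x ∈ T.V p ↔ toEquiv x ∈ T'.V p

/-- The same tree with another valuation. -/
def withValuation (T : TreeModel.{u}) (V : PropLetter → Set T.W) : TreeModel.{u} :=
  { T with V := V }

/-- The model `ρ(T)`, in which `p` is interpreted as `ρ p` is in `T`. -/
def rename (T : TreeModel.{u}) (ρ : PropLetter → PropLetter) : TreeModel.{u} :=
  T.withValuation fun p => T.V (ρ p)

/-- The model `T^[p ↦ S]`: the valuation of `p` is changed to `S`. -/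
def update (T : TreeModel.{u}) (p : PropLetter) (S : Set T.W) : TreeModel.{u} :=
  T.withValuation (Function.update T.V p S)

/-- The submodel induced by a set of nodes that forms a tree. -/
def restrict (T : TreeModel.{u}) (S : Set T.W) (hS : IsTree fun x y : S => T.R x y) :
    TreeModel.{u} where
  W := S
  R := fun x y => T.R x y
  V := fun p => {x | (x : T.W) ∈ T.V p}
  isTree := hS

/-- The nodes reachable from `n` in finitely many steps. -/
def generatedSet (T : TreeModel.{u}) (n : T.W) : Set T.W :=
  {m | Relation.ReflTransGen T.R n m}

/-- Being neighbours in `T` (in either direction), both satisfying `p`. -/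
def Adj (T : TreeModel.{u}) (p : PropLetter) (x y : T.W) : Prop :=
  (T.R x y ∨ T.R y x) ∧ x ∈ T.V p ∧ y ∈ T.V p

/-- The nodes that are joined to `n` by a path (upwards and downwards steps) through nodes
satisfying `p`. If `n` satisfies `p`, this is the largest subtree of `T` that contains `n` and
contains only nodes satisfying `p`. -/
def subtreeSet (T : TreeModel.{u}) (n : T.W) (p : PropLetter) : Set T.W :=
  {m | Relation.ReflTransGen (T.Adj p) n m}

theorem wellFounded_R (T : TreeModel.{u}) : WellFounded T.R := by
  obtain ⟨r, hr, hreach, huniq⟩ := T.isTree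
  refine ⟨fun x => ?_⟩
  have hx := hreach x
  induction hx with
  | refl => exact ⟨_, fun y hy => absurd hy (hr y)⟩
  | @tail b c _ hbc ih => exact ⟨_, fun y hy => huniq b y c hbc hy ▸ ih⟩

theorem isTree_generatedSet (T : TreeModel.{u}) (n : T.W) :
    IsTree fun x y : T.generatedSet n => T.R x y := by
  have hwf := T.wellFounded_R
  obtain ⟨r, hr, hreach, huniq⟩ := T.isTree
  have hac : ∀ x y, Relation.ReflTransGen T.R x y → ¬ T.R y x := by
    intro x y hxy hyx
    have h : Relation.TransGen T.R x x := Relation.TransGen.tail' hxy hyx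
    exact hwf.transGen.irrefl.irrefl x h
  refine ⟨⟨n, Relation.ReflTransGen.refl⟩, fun x hx => hac n x x.2 hx, ?_, ?_⟩
  · rintro ⟨x, hx⟩
    have hx' : Relation.ReflTransGen T.R n x := hx
    induction hx' with
    | refl => exact Relation.ReflTransGen.refl
    | @tail b c hb hbc ih => exact (ih hb).tail hbc
  · rintro x y z hx hy
    exact Subtype.ext (huniq _ _ _ hx hy)

theorem isTree_subtreeSet (T : TreeModel.{u}) (n : T.W) (p : PropLetter) :
    IsTree fun x y : T.subtreeSet n p => T.R x y := by
  have hwf := T.wellFounded_R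
  obtain ⟨-, -, -, huniq⟩ := T.isTree
  have hsymm : ∀ x y, T.Adj p x y → T.Adj p y x := fun x y h => ⟨h.1.symm, h.2.2, h.2.1⟩
  have hne : (T.subtreeSet n p).Nonempty := ⟨n, Relation.ReflTransGen.refl⟩
  obtain ⟨r, hrC, hmin⟩ := hwf.has_min _ hne
  have hsub : ∀ x, Relation.ReflTransGen (T.Adj p) r x → x ∈ T.subtreeSet n p :=
    fun x hx => Relation.ReflTransGen.trans hrC hx
  have key : ∀ x, ∀ h : Relation.ReflTransGen (T.Adj p) r x,
      Relation.ReflTransGen (fun x y : T.subtreeSet n p => T.R x y) ⟨r, hrC⟩ ⟨x, hsub x h⟩ := by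
    intro x h
    induction h with
    | refl => exact Relation.ReflTransGen.refl
    | @tail b c hb hbc ih =>
      rcases hbc.1 with h | h
      · exact ih.tail h
      · rcases Relation.ReflTransGen.cases_tail ih with h' | ⟨d, hd, hdb⟩
        · have e : b = r := congrArg Subtype.val h'
          exact absurd (e ▸ h) (hmin c (hsub c (hb.tail hbc)))
        · have e : d = ⟨c, hsub c (hb.tail hbc)⟩ := Subtype.ext (huniq _ _ _ hdb h)
          exact e ▸ hd
  have hrev : ∀ x, Relation.ReflTransGen (T.Adj p) n x → Relation.ReflTransGen (T.Adj p) x n := by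
    intro x hx
    induction hx with
    | refl => exact Relation.ReflTransGen.refl
    | tail _ h ih => exact Relation.ReflTransGen.head (hsymm _ _ h) ih
  refine ⟨⟨r, hrC⟩, fun x hx => hmin x x.2 hx, ?_, ?_⟩
  · rintro ⟨x, hx⟩
    exact key x ((hrev r hrC).trans hx)
  · intro x y z hx hy
    exact Subtype.ext (huniq _ _ _ hx hy)

/-- The submodel `T_n` generated by `n`. -/
def generated (T : TreeModel.{u}) (n : T.W) : TreeModel.{u} :=
  T.restrict (T.generatedSet n) (T.isTree_generatedSet n)

/-- The node `n`, seen in `T_n`. -/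
def generatedPoint (T : TreeModel.{u}) (n : T.W) : (T.generated n).W :=
  ⟨n, Relation.ReflTransGen.refl⟩

/-- `Subtree(T, n, p)`. -/
def subtree (T : TreeModel.{u}) (n : T.W) (p : PropLetter) : TreeModel.{u} :=
  T.restrict (T.subtreeSet n p) (T.isTree_subtreeSet n p)

/-- The node `n` (which need not be the root), seen in `Subtree(T, n, p)`. -/
def subtreePoint (T : TreeModel.{u}) (n : T.W) (p : PropLetter) : (T.subtree n p).W :=
  ⟨n, Relation.ReflTransGen.refl⟩

end TreeModel

/-- A set of formulas with a truth relation between formulas and pointed tree models. -/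
structure TreeLogic where
  Fml : Type v
  Sat : Fml → (T : TreeModel.{u}) → T.W → Prop

namespace TreeLogic

/-- The logic `L'` extends `L`, i.e. `L` is no more expressive than `L'`, on trees: there is a map
from `L`-formulas to `L'`-formulas that preserves truth in all pointed tree models. -/
def ContainedIn (L : TreeLogic.{u, v}) (L' : TreeLogic.{u, w}) : Prop :=
  ∃ f : L.Fml → L'.Fml, ∀ (φ : L.Fml) (T : TreeModel.{u}) (n : T.W),
    L.Sat φ T n ↔ L'.Sat (f φ) T n

/-- An abstract modal logic on trees: formulas are invariant for isomorphisms, and the logic is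
closed under the Boolean operations, renaming, and relativisation on trees. -/
structure IsAbstractModalLogic (L : TreeLogic.{u, v}) : Prop where
  iso_invariant : ∀ (φ : L.Fml) (T T' : TreeModel.{u}) (e : T.Iso T') (n : T.W),
    L.Sat φ T n ↔ L.Sat φ T' (e.toEquiv n)
  negation : ∀ φ : L.Fml, ∃ ψ : L.Fml, ∀ (T : TreeModel.{u}) (n : T.W),
    L.Sat ψ T n ↔ ¬ L.Sat φ T n
  conjunction : ∀ φ ψ : L.Fml, ∃ χ : L.Fml, ∀ (T : TreeModel.{u}) (n : T.W),
    L.Sat χ T n ↔ L.Sat φ T n ∧ L.Sat ψ T n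
  renames : ∀ (ρ : PropLetter → PropLetter) (φ : L.Fml), ∃ ψ : L.Fml,
    ∀ (T : TreeModel.{u}) (n : T.W), L.Sat ψ T n ↔ L.Sat φ (T.rename ρ) n
  relativisation : ∀ (φ : L.Fml) (p : PropLetter), ∃ ψ : L.Fml,
    ∀ (T : TreeModel.{u}) (n : T.W),
      L.Sat ψ T n ↔ n ∈ T.V p ∧ L.Sat φ (T.subtree n p) (T.subtreePoint n p)

/-- Closure under substitution of a formula for a proposition letter. -/
def ClosedUnderSubstitution (L : TreeLogic.{u, v}) : Prop :=
  ∀ (φ ψ : L.Fml) (p : PropLetter), ∃ χ : L.Fml, ∀ (T : TreeModel.{u}) (n : T.W),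
    L.Sat χ T n ↔ L.Sat φ (T.update p {m | L.Sat ψ T m}) n

/-- Some pointed tree model satisfies all formulas in `Γ`. -/
def Satisfiable (L : TreeLogic.{u, v}) (Γ : Set L.Fml) : Prop :=
  ∃ (T : TreeModel.{u}) (n : T.W), ∀ φ ∈ Γ, L.Sat φ T n

/-- Compactness on trees. -/
def Compactness (L : TreeLogic.{u, v}) : Prop :=
  ∀ Γ : Set L.Fml, (∀ Δ ⊆ Γ, Δ.Finite → L.Satisfiable Δ) → L.Satisfiable Γ

/-- The Löwenheim–Skolem property on trees. -/
def LowenheimSkolem (L : TreeLogic.{u, v}) : Prop :=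
  ∀ Γ : Set L.Fml, L.Satisfiable Γ →
    ∃ (T : TreeModel.{u}) (n : T.W), Countable T.W ∧ ∀ φ ∈ Γ, L.Sat φ T n

/-- Invariance for generated submodels on trees. -/
def GeneratedSubmodelInvariant (L : TreeLogic.{u, v}) : Prop :=
  ∀ (φ : L.Fml) (T : TreeModel.{u}) (n : T.W),
    L.Sat φ T n ↔ L.Sat φ (T.generated n) (T.generatedPoint n)

end TreeLogic

/-- Formulas of graded modal logic. -/
inductive GMLFormula : Type
  | letter (p : PropLetter) : GMLFormula
  | bot : GMLFormula
  | neg (φ : GMLFormula) : GMLFormula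
  | and (φ ψ : GMLFormula) : GMLFormula
  | dia (k : ℕ) (φ : GMLFormula) : GMLFormula

/-- Truth of graded modal formulas; `dia k φ` says that at least `k` successors satisfy `φ`. -/
def GMLFormula.Sat (T : TreeModel.{u}) : GMLFormula → T.W → Prop
  | .letter p, n => n ∈ T.V p
  | .bot, _ => False
  | .neg φ, n => ¬ φ.Sat T n
  | .and φ ψ, n => φ.Sat T n ∧ ψ.Sat T n
  | .dia k φ, n => (k : ℕ∞) ≤ Set.encard {m | T.R n m ∧ φ.Sat T m}

/-- Graded modal logic on trees. -/
def GML : TreeLogic.{u, 0} where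
  Fml := GMLFormula
  Sat := fun φ T n => φ.Sat T n

end GMLTrees

/-! ### Definable properties and their closure conditions -/

namespace GMLTrees

open Relation

/-! The properties expressible in L contain those of graded modal logic and are closed under Boolean
operations, graded modalities, renaming and relativisation to definable properties. Compactness is
applied to them in one recurring way. Two versions of a model are coded in a single tree, with
separate families of letters for two valuations and a letter that carves out a submodel. The
statement that Q distinguishes the two versions is then itself definable.

Invariance for generated submodels needs compactness only (`generated_iff`). If it fails for Q, then
deleting the root of some generated tree T_a changes Q at a node n further down. Copies of T_a are
glued into a chain, the root of each copy being the point n of the previous one. The N-th property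
in a recursively defined sequence says that deleting the top of the current copy changes Q, and that
the top has the preceding property in the earlier part. It forces N proper ancestors and is realised
by the chain. Compactness would give a node with infinitely many ancestors, which no tree has.

Consequently graded bisimulations, which between trees are isomorphisms of generated submodels,
preserve Q. Compactness then bounds the letters and the depth that Q can see
(`exists_similar_lettersBelow`).

The depth is next reduced to zero, one level at a time (`exists_similar_pred`). Sort the children of
a node by the formulas of a finite set F that they satisfy. In a countable tree, removing children
from a class that stays infinite does not change its size, so Q does not notice. By compactness and
Löwenheim–Skolem, "infinite" can be replaced by "at least g" for some finite g. The classes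
therefore matter only up to g, and graded formulas at the parent express these counts. At depth zero
Q is determined by finitely many graded formulas, so it is a finite disjunction of types.

Conversely, graded modal logic has Löwenheim–Skolem by closing a point under witnesses, and
Compactness by an ultraproduct cut down to the part generated by the roots. Less expressive logics
inherit both. -/

/-- A property of pointed tree models. -/
abbrev Query : Type (u + 1) := ∀ T : TreeModel.{u}, T.W → Prop

/-- The logic `L` has a formula that expresses the property `Q`. -/
def TreeLogic.Definable (L : TreeLogic.{u, v}) (Q : Query.{u}) : Prop :=
  ∃ φ : L.Fml, ∀ (T : TreeModel.{u}) (n : T.W), L.Sat φ T n ↔ Q T n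

/-- The abstract modal logics that are closed under substitution and extend graded modal logic. -/
structure TreeLogic.IsModalExtension (L : TreeLogic.{u, v}) : Prop where
  isAbstract : L.IsAbstractModalLogic
  subst : L.ClosedUnderSubstitution
  ext : GML.{u}.ContainedIn L

namespace TreeLogic.IsModalExtension

variable {L : TreeLogic.{u, v}} (hL : L.IsModalExtension)
include hL

theorem definable_gml (α : GMLFormula) : L.Definable fun T n => α.Sat T n := by
  obtain ⟨f, hf⟩ := hL.ext
  exact ⟨f α, fun T n => (hf α T n).symm⟩

theorem definable_letter (p : PropLetter) : L.Definable fun T n => n ∈ T.V p :=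
  hL.definable_gml (.letter p)

theorem definable_not {Q : Query.{u}} (hQ : L.Definable Q) :
    L.Definable fun T n => ¬ Q T n := by
  obtain ⟨φ, hφ⟩ := hQ
  obtain ⟨ψ, hψ⟩ := hL.isAbstract.negation φ
  exact ⟨ψ, fun T n => by rw [hψ, hφ]⟩

theorem definable_and {P Q : Query.{u}} (hP : L.Definable P) (hQ : L.Definable Q) :
    L.Definable fun T n => P T n ∧ Q T n := by
  obtain ⟨φ, hφ⟩ := hP
  obtain ⟨ψ, hψ⟩ := hQ
  obtain ⟨χ, hχ⟩ := hL.isAbstract.conjunction φ ψ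
  exact ⟨χ, fun T n => by rw [hχ, hφ, hψ]⟩

theorem definable_imp {P Q : Query.{u}} (hP : L.Definable P) (hQ : L.Definable Q) :
    L.Definable fun T n => P T n → Q T n := by
  obtain ⟨φ, hφ⟩ := hL.definable_not (hL.definable_and hP (hL.definable_not hQ))
  exact ⟨φ, fun T n => by rw [hφ]; tauto⟩

theorem definable_iff {P Q : Query.{u}} (hP : L.Definable P) (hQ : L.Definable Q) :
    L.Definable fun T n => (P T n ↔ Q T n) := by
  obtain ⟨φ, hφ⟩ := hL.definable_and (hL.definable_imp hP hQ) (hL.definable_imp hQ hP)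
  exact ⟨φ, fun T n => by rw [hφ]; tauto⟩

theorem definable_true : L.Definable fun _ _ => True := by
  obtain ⟨φ, hφ⟩ := hL.definable_gml (.neg .bot)
  exact ⟨φ, fun T n => by rw [hφ]; simp [GMLFormula.Sat]⟩

theorem definable_forall_mem {ι : Type*} {s : Set ι} (hs : s.Finite) {P : ι → Query.{u}}
    (hP : ∀ i ∈ s, L.Definable (P i)) : L.Definable fun T n => ∀ i ∈ s, P i T n := by
  induction s, hs using Set.Finite.induction_on with
  | empty => simpa using hL.definable_true
  | @insert a s _ _ ih =>
    simp only [Set.forall_mem_insert] at hP ⊢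
    exact hL.definable_and hP.1 (ih hP.2)

theorem definable_rename {Q : Query.{u}} (hQ : L.Definable Q) (ρ : PropLetter → PropLetter) :
    L.Definable fun T n => Q (T.rename ρ) n := by
  obtain ⟨φ, hφ⟩ := hQ
  obtain ⟨ψ, hψ⟩ := hL.isAbstract.renames ρ φ
  exact ⟨ψ, fun T n => by rw [hψ]; exact hφ _ _⟩

theorem definable_update {P Q : Query.{u}} (hQ : L.Definable Q) (hP : L.Definable P)
    (p : PropLetter) : L.Definable fun T n => Q (T.update p {m | P T m}) n := by
  obtain ⟨φ, hφ⟩ := hQ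
  obtain ⟨ψ, hψ⟩ := hP
  obtain ⟨χ, hχ⟩ := hL.subst φ ψ p
  refine ⟨χ, fun T n => ?_⟩
  have e : {m | L.Sat ψ T m} = {m | P T m} := Set.ext fun m => hψ T m
  exact (hχ T n).trans (e ▸ hφ _ _)

theorem definable_subtree {Q : Query.{u}} (hQ : L.Definable Q) (p : PropLetter) :
    L.Definable fun T n => n ∈ T.V p ∧ Q (T.subtree n p) (T.subtreePoint n p) := by
  obtain ⟨φ, hφ⟩ := hQ
  obtain ⟨ψ, hψ⟩ := hL.isAbstract.relativisation φ p
  exact ⟨ψ, fun T n => by rw [hψ, hφ]⟩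

/-- Relativisation to a definable property. -/
theorem definable_relativise {Q A : Query.{u}} (hQ : L.Definable Q) (hA : L.Definable A)
    (p : PropLetter) :
    L.Definable fun T n => A T n ∧
      Q ((T.update p {m | A T m}).subtree n p)
        (TreeModel.subtreePoint (T.update p {m | A T m}) n p) := by
  obtain ⟨φ, hφ⟩ := hL.definable_update (hL.definable_subtree hQ p) hA p
  refine ⟨φ, fun T n => (hφ T n).trans (and_congr_left' ?_)⟩
  change n ∈ Function.update T.V p {m | A T m} p ↔ _
  rw [Function.update_self]
  rfl

/-- Closure under substitution turns the graded modality of a letter into an operation on arbitrary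
definable properties. -/
theorem definable_dia {P : Query.{u}} (hP : L.Definable P) (k : ℕ) :
    L.Definable fun T n => (k : ℕ∞) ≤ Set.encard {m | T.R n m ∧ P T m} := by
  obtain ⟨φ, hφ⟩ := hL.definable_update (hL.definable_gml (.dia k (.letter 0))) hP 0
  refine ⟨φ, fun T n => ?_⟩
  rw [hφ]
  change (k : ℕ∞) ≤ Set.encard {m | T.R n m ∧ m ∈ Function.update T.V 0 {m | P T m} 0} ↔ _
  rw [Function.update_self]
  rfl

theorem definable_box {P : Query.{u}} (hP : L.Definable P) :
    L.Definable fun T n => ∀ m, T.R n m → P T m := by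
  obtain ⟨φ, hφ⟩ := hL.definable_not (hL.definable_dia (hL.definable_not hP) 1)
  refine ⟨φ, fun T n => ?_⟩
  rw [hφ]
  simp [Set.one_le_encard_iff_nonempty, Set.Nonempty]

theorem iso_iff {Q : Query.{u}} (hQ : L.Definable Q) {T T' : TreeModel.{u}} (e : T.Iso T')
    (n : T.W) : Q T n ↔ Q T' (e.toEquiv n) := by
  obtain ⟨φ, hφ⟩ := hQ
  rw [← hφ, ← hφ]
  exact hL.isAbstract.iso_invariant φ T T' e n

/-- An embedding of `T` onto a submodel of `T'`, up to renaming, preserves definable properties. -/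
theorem restrict_iff {Q : Query.{u}} (hQ : L.Definable Q) {T T' : TreeModel.{u}} {S : Set T'.W}
    (hS : IsTree fun x y : S => T'.R x y) (ρ : PropLetter → PropLetter) (f : T.W → T'.W)
    (hf : Function.Injective f) (hR : ∀ x y, T.R x y ↔ T'.R (f x) (f y))
    (hV : ∀ i x, x ∈ T.V i ↔ f x ∈ T'.V (ρ i)) (hr : Set.range f = S) (n : T.W) (n' : S)
    (hn : f n = n') : Q T n ↔ Q ((T'.restrict S hS).rename ρ) n' := by
  let g : T.W → S := fun x => ⟨f x, hr ▸ ⟨x, rfl⟩⟩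
  have hg : Function.Bijective g := by
    refine ⟨fun x y h => hf (congrArg Subtype.val h), ?_⟩
    rintro ⟨y, hy⟩
    obtain ⟨x, rfl⟩ := hr ▸ hy
    exact ⟨x, rfl⟩
  have h := hL.iso_iff hQ (T' := (T'.restrict S hS).rename ρ)
    ⟨Equiv.ofBijective g hg, hR, hV⟩ n
  have e : g n = n' := Subtype.ext hn
  rw [h]
  exact e ▸ Iff.rfl

/-- The case of `restrict_iff` in which no letter is renamed. -/
theorem restrict_iff' {Q : Query.{u}} (hQ : L.Definable Q) {T T' : TreeModel.{u}} {S : Set T'.W}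
    (hS : IsTree fun x y : S => T'.R x y) (f : T.W → T'.W)
    (hf : Function.Injective f) (hR : ∀ x y, T.R x y ↔ T'.R (f x) (f y))
    (hV : ∀ i x, x ∈ T.V i ↔ f x ∈ T'.V i) (hr : Set.range f = S) (n : T.W) (n' : S)
    (hn : f n = n') : Q T n ↔ Q (T'.restrict S hS) n' :=
  hL.restrict_iff hQ hS id f hf hR hV hr n n' hn

end TreeLogic.IsModalExtension

/-- Compactness for a sequence of definable properties. -/
theorem TreeLogic.Compactness.exists_forall {L : TreeLogic.{u, v}} (hc : L.Compactness)
    {P : ℕ → Query.{u}} (hP : ∀ i, L.Definable (P i))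
    (h : ∀ N, ∃ (T : TreeModel.{u}) (n : T.W), ∀ i ≤ N, P i T n) :
    ∃ Γ : Set L.Fml, L.Satisfiable Γ ∧
      ∀ (T : TreeModel.{u}) (n : T.W), (∀ φ ∈ Γ, L.Sat φ T n) → ∀ i, P i T n := by
  classical
  choose φ hφ using hP
  -- The set of formulas is returned, rather than one model of it, so that Löwenheim–Skolem can
  -- still be applied to it.
  refine ⟨Set.range φ, hc _ fun Δ hΔ hfin => ?_, fun T n hT i => (hφ i T n).1 (hT _ ⟨i, rfl⟩)⟩
  lift Δ to Finset L.Fml using hfin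
  rw [← Set.image_univ, Finset.subset_set_image_iff] at hΔ
  obtain ⟨s, -, rfl⟩ := hΔ
  obtain ⟨T, n, hT⟩ := h (s.sup id)
  refine ⟨T, n, ?_⟩
  intro ψ hψ
  obtain ⟨i, hi, rfl⟩ := Finset.mem_image.1 (Finset.mem_coe.1 hψ)
  exact (hφ i T n).2 (hT i (Finset.le_sup (f := id) hi))

end GMLTrees

/-! ### Components, ancestors and gluing of trees -/

namespace GMLTrees

open Relation

namespace TreeModel

theorem parent_unique (T : TreeModel.{u}) {x y z : T.W} (hx : T.R x z) (hy : T.R y z) : x = y := by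
  obtain ⟨_, _, _, h⟩ := T.isTree
  exact h x y z hx hy

theorem not_transGen_self (T : TreeModel.{u}) (x : T.W) : ¬ TransGen T.R x x :=
  fun h => T.wellFounded_R.transGen.irrefl.irrefl x h

theorem update_V_self (T : TreeModel.{u}) (p : PropLetter) (S : Set T.W) :
    (T.update p S).V p = S :=
  Function.update_self ..

theorem update_V_of_ne (T : TreeModel.{u}) {p q : PropLetter} (S : Set T.W) (h : q ≠ p) :
    (T.update p S).V q = T.V q :=
  Function.update_of_ne h ..

theorem adj_symm (T : TreeModel.{u}) {p : PropLetter} {x y : T.W} (h : T.Adj p x y) :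
    T.Adj p y x :=
  ⟨h.1.symm, h.2.2, h.2.1⟩

theorem adj_reflTransGen_symm (T : TreeModel.{u}) {p : PropLetter} {x y : T.W}
    (h : ReflTransGen (T.Adj p) x y) : ReflTransGen (T.Adj p) y x := by
  induction h with
  | refl => exact .refl
  | tail _ h ih => exact .head (T.adj_symm h) ih

theorem subtreeSet_subset {T : TreeModel.{u}} {p : PropLetter} {x : T.W} (hx : x ∈ T.V p) :
    T.subtreeSet x p ⊆ T.V p := by
  intro y hy
  rcases ReflTransGen.cases_tail hy with rfl | ⟨_, _, h⟩
  · exact hx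
  · exact h.2.2

theorem subtreeSet_eq_range {T T' : TreeModel.{u}} {p : PropLetter} (f : T.W → T'.W)
    (hR : ∀ x y, T.R x y → T'.R (f x) (f y)) (hp : ∀ x, f x ∈ T'.V p)
    (hc : ∀ x y, T'.R (f x) y ∨ T'.R y (f x) → y ∈ T'.V p → y ∈ Set.range f) (n : T.W) :
    T'.subtreeSet (f n) p = Set.range f := by
  ext y
  constructor
  · intro hy
    have hy' : ReflTransGen (T'.Adj p) (f n) y := hy
    induction hy' with
    | refl => exact ⟨n, rfl⟩
    | tail hb h ih =>
      obtain ⟨x, rfl⟩ := ih hb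
      exact hc x _ h.1 h.2.2
  · rintro ⟨x, rfl⟩
    obtain ⟨r, -, hr, -⟩ := T.isTree
    have key : ∀ x, ReflTransGen (T'.Adj p) (f r) (f x) := fun x =>
      (hr x).lift f fun a b hab => ⟨.inl (hR a b hab), hp a, hp b⟩
    exact (T'.adj_reflTransGen_symm (key n)).trans (key x)

/-- `x` has at least `N` proper ancestors. -/
def HasAncestors (T : TreeModel.{u}) : ℕ → T.W → Prop
  | 0, _ => True
  | N + 1, x => ∃ y, TransGen T.R y x ∧ T.HasAncestors N y

theorem HasAncestors.mono {T : TreeModel.{u}} {N : ℕ} {x y : T.W} (h : T.HasAncestors N x)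
    (hxy : ReflTransGen T.R x y) : T.HasAncestors N y := by
  cases N with
  | zero => trivial
  | succ N =>
    obtain ⟨z, hz, hN⟩ := h
    exact ⟨z, hz.trans_left hxy, hN⟩

/-- The ancestors of a child of b are b and the ancestors of b, so a bound grows by one with each
step from the root. This is what the compactness argument for generated submodels contradicts. -/
theorem exists_not_hasAncestors (T : TreeModel.{u}) (x : T.W) : ∃ N, ¬ T.HasAncestors N x := by
  obtain ⟨r, hr, hreach, -⟩ := T.isTree
  induction hreach x with
  | refl =>
    refine ⟨1, ?_⟩
    rintro ⟨y, hy, -⟩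
    obtain ⟨z, -, hz⟩ := TransGen.tail'_iff.1 hy
    exact hr z hz
  | @tail b c _ hbc ih =>
    obtain ⟨N, hN⟩ := ih
    refine ⟨N + 1, ?_⟩
    rintro ⟨y, hy, hyN⟩
    obtain ⟨z, hz, hzc⟩ := TransGen.tail'_iff.1 hy
    obtain rfl := T.parent_unique hzc hbc
    exact hN (hyN.mono hz)

theorem HasAncestors.of_restrict {T : TreeModel.{u}} {S : Set T.W}
    {hS : IsTree fun x y : S => T.R x y} {N : ℕ} {x : S} (h : (T.restrict S hS).HasAncestors N x) :
    T.HasAncestors N x := by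
  induction N generalizing x with
  | zero => trivial
  | succ N ih =>
    obtain ⟨y, hy, hN⟩ := h
    exact ⟨Subtype.val (p := (· ∈ S)) y, hy.lift Subtype.val fun _ _ h => h, ih hN⟩

theorem HasAncestors.of_rename {T : TreeModel.{u}} {ρ : PropLetter → PropLetter} {N : ℕ} {x : T.W}
    (h : (T.rename ρ).HasAncestors N x) : T.HasAncestors N x := by
  induction N generalizing x with
  | zero => trivial
  | succ N ih =>
    obtain ⟨y, hy, hN⟩ := h
    exact ⟨y, hy, ih hN⟩

open Classical in
/-- The map from the second tree into the tree in which its root `r` is glued to the node `m` of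
the first one. -/
noncomputable def glueMap {A : Type*} {B : Type*} (m : A) (r : B) (b : B) : A ⊕ {b : B // b ≠ r} :=
  if h : b = r then .inl m else .inr ⟨b, h⟩

/-- The edge relation after gluing the root `r` of the second tree to the node `m` of the first. -/
def glueRel {A : Type*} {B : Type*} (RA : A → A → Prop) (RB : B → B → Prop) (m : A) (r : B) :
    A ⊕ {b : B // b ≠ r} → A ⊕ {b : B // b ≠ r} → Prop
  | .inl a, .inl a' => RA a a'
  | .inl a, .inr b => a = m ∧ RB r b
  | .inr _, .inl _ => False
  | .inr b, .inr b' => RB b b'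

theorem glueMap_root {A : Type*} {B : Type*} (m : A) (r : B) : glueMap m r r = .inl m :=
  dif_pos rfl

theorem glueMap_of_ne {A : Type*} {B : Type*} (m : A) {r b : B} (h : b ≠ r) :
    glueMap m r b = .inr ⟨b, h⟩ :=
  dif_neg h

theorem glueMap_injective {A : Type*} {B : Type*} (m : A) (r : B) :
    Function.Injective (glueMap m r) := by
  intro b b' h
  by_cases hb : b = r <;> by_cases hb' : b' = r <;> simp_all [glueMap]

theorem glueRel_glueMap {A B : TreeModel.{u}} (m : A.W) {r : B.W}
    (hr : ∀ x, ReflTransGen B.R r x) (x y : B.W) :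
    B.R x y ↔ glueRel A.R B.R m r (glueMap m r x) (glueMap m r y) := by
  have hno : ∀ x, ¬ B.R x r := fun x h => B.not_transGen_self r (TransGen.tail' (hr x) h)
  by_cases hx : x = r <;> by_cases hy : y = r
  · subst hx hy
    rw [glueMap_root]
    exact iff_of_false (hno _) fun h => A.not_transGen_self m (.single h)
  · subst hx
    rw [glueMap_root, glueMap_of_ne m hy]
    simp [glueRel]
  · subst hy
    rw [glueMap_root, glueMap_of_ne m hx]
    simp [glueRel, hno]
  · rw [glueMap_of_ne m hx, glueMap_of_ne m hy]
    simp [glueRel]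

/-- The tree `B`, with root `r`, is glued below the node `m` of `A`, by identifying `r` with `m`. -/
def glue (A B : TreeModel.{u}) (m : A.W) (r : B.W) (hr : ∀ x, ReflTransGen B.R r x)
    (V : PropLetter → Set (A.W ⊕ {b : B.W // b ≠ r})) : TreeModel.{u} where
  W := A.W ⊕ {b : B.W // b ≠ r}
  R := glueRel A.R B.R m r
  V := V
  isTree := by
    obtain ⟨s, hs, hreach, -⟩ := A.isTree
    have hA : ∀ a, ReflTransGen (glueRel A.R B.R m r) (.inl s) (.inl a) := fun a =>
      (hreach a).lift Sum.inl fun _ _ h => h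
    refine ⟨.inl s, ?_, ?_, ?_⟩
    · rintro (a | b) h
      · exact hs a h
      · exact h
    · rintro (a | ⟨b, hb⟩)
      · exact hA a
      · have h := (hr b).lift (p := glueRel A.R B.R m r) (glueMap m r) fun x y h =>
          (glueRel_glueMap m hr x y).1 h
        rw [Function.onFun, glueMap_root, glueMap_of_ne m hb] at h
        exact (hA m).trans h
    · rintro (a | b) (a' | b') (a'' | b'') h h' <;> simp only [glueRel] at h h'
      · rw [A.parent_unique h h']
      · rw [h.1, h'.1]
      · exact absurd (B.parent_unique h.2 h').symm b'.2
      · exact absurd (B.parent_unique h'.2 h).symm b.2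
      · rw [Subtype.ext (B.parent_unique h h')]

end TreeModel

namespace TreeLogic.IsModalExtension

variable {L : TreeLogic.{u, v}} (hL : L.IsModalExtension)
include hL

/-- An embedding of `T` onto a component of a letter preserves definable properties, up to
renaming. -/
theorem subtree_iff {Q : Query.{u}} (hQ : L.Definable Q) {T T' : TreeModel.{u}} {p : PropLetter}
    (ρ : PropLetter → PropLetter) (f : T.W → T'.W)
    (hf : Function.Injective f) (hR : ∀ x y, T.R x y ↔ T'.R (f x) (f y))
    (hV : ∀ i x, x ∈ T.V i ↔ f x ∈ T'.V (ρ i)) (hp : ∀ x, f x ∈ T'.V p)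
    (hc : ∀ x y, T'.R (f x) y ∨ T'.R y (f x) → y ∈ T'.V p → y ∈ Set.range f)
    (n : T.W) (n' : T'.W) (hn : f n = n') :
    Q T n ↔ Q ((T'.subtree n' p).rename ρ) (T'.subtreePoint n' p) := by
  subst hn
  exact hL.restrict_iff hQ _ ρ f hf hR hV
    (TreeModel.subtreeSet_eq_range f (fun x y => (hR x y).1) hp hc n).symm n _ rfl

end TreeLogic.IsModalExtension

/-- `A` holds at the current node, and `Q` holds there in the component of `A`, after renaming. -/
def Query.within (Q : Query.{u}) (ρ : PropLetter → PropLetter) (A : Query.{u}) : Query.{u} :=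
  fun T x => A T x ∧ Q (((T.update 0 {m | A T m}).subtree x 0).rename ρ)
    (TreeModel.subtreePoint (T.update 0 {m | A T m}) x 0)

theorem TreeLogic.IsModalExtension.definable_within {L : TreeLogic.{u, v}}
    (hL : L.IsModalExtension) {Q A : Query.{u}} (hQ : L.Definable Q) (hA : L.Definable A)
    (ρ : PropLetter → PropLetter) : L.Definable (Q.within ρ A) :=
  hL.definable_relativise (hL.definable_rename hQ ρ) hA 0

/-- The two updated models differ only in the letter 0, and `hρ` keeps Q from reading that letter.
-/
theorem Query.within_congr {Q A A' : Query.{u}} {ρ : PropLetter → PropLetter} {T : TreeModel.{u}}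
    {x : T.W} (hx : A T x ↔ A' T x)
    (h : (T.update 0 {m | A T m}).subtreeSet x 0 = (T.update 0 {m | A' T m}).subtreeSet x 0)
    {L : TreeLogic.{u, v}} (hL : L.IsModalExtension) (hQ : L.Definable Q)
    (hρ : ∀ i, ρ i ≠ 0) : Q.within ρ A T x ↔ Q.within ρ A' T x := by
  refine and_congr hx ?_
  have key : ∀ i (z : T.W), z ∈ (T.update 0 {m | A T m}).V (ρ i) ↔
      z ∈ (T.update 0 {m | A' T m}).V (ρ i) := fun i z => by
    rw [TreeModel.update_V_of_ne _ _ (hρ i), TreeModel.update_V_of_ne _ _ (hρ i)]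
    exact Iff.rfl
  refine hL.restrict_iff' hQ (T := ((T.update 0 {m | A T m}).subtree x 0).rename ρ)
    (T' := (T.update 0 {m | A' T m}).rename ρ)
    (TreeModel.isTree_subtreeSet (T.update 0 {m | A' T m}) x 0) Subtype.val
    Subtype.val_injective (fun _ _ => Iff.rfl) (fun i y => key i _) (Subtype.range_val.trans h) _ _ rfl

end GMLTrees

/-! ### Invariance for generated submodels -/

namespace GMLTrees

open Relation

/-- The nodes in the letter `0` that have no child in the letter `1` and that, if they are in the
letter `1` themselves, have the property `P`, read in the component of the letter `2`. -/
def Query.ascentDomain (P : Query.{u}) : Query.{u} :=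
  fun T x => x ∈ T.V 0 ∧ (∀ y, T.R x y → y ∉ T.V 1) ∧
    (x ∈ T.V 1 → x ∈ T.V 2 ∧
      P ((T.subtree x 2).rename (2 * · + 4)) (T.subtreePoint x 2))

/-- Given a property `Q`, a property that only nodes with at least `N` proper ancestors have. -/
def Query.ascent (Q : Query.{u}) : ℕ → Query.{u}
  | 0 => fun _ _ => True
  | N + 1 => fun T x => x ∉ T.V 1 ∧
      ¬ (Q.within (2 * · + 3) (Q.ascent N).ascentDomain T x ↔
        Q.within (2 * · + 3) (fun T x => x ∉ T.V 1 ∧ (Q.ascent N).ascentDomain T x) T x)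

namespace TreeLogic.IsModalExtension

variable {L : TreeLogic.{u, v}} (hL : L.IsModalExtension)
include hL

theorem definable_ascentDomain {P : Query.{u}} (hP : L.Definable P) :
    L.Definable P.ascentDomain :=
  hL.definable_and (hL.definable_letter 0) <| hL.definable_and
    (hL.definable_box (hL.definable_not (hL.definable_letter 1))) <|
    hL.definable_imp (hL.definable_letter 1) (hL.definable_subtree (hL.definable_rename hP _) 2)

theorem definable_ascent {Q : Query.{u}} (hQ : L.Definable Q) (N : ℕ) :
    L.Definable (Q.ascent N) := by
  induction N with
  | zero => exact hL.definable_true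
  | succ N ih =>
    have h := hL.definable_ascentDomain ih
    have h1 := hL.definable_not (hL.definable_letter 1)
    exact hL.definable_and h1 <| hL.definable_not <| hL.definable_iff
      (hL.definable_within hQ h _) (hL.definable_within hQ (hL.definable_and h1 h) _)

/-- Excluding the letter 1 can change Q at x only if the component of x contains a node z in the
letter 1. Nodes of the domain have no child in that letter, so z is the top of the component and x
lies strictly below it. Since z has the N-th property in the component of the letter 2, induction
applies to z. -/
theorem hasAncestors_of_ascent {Q : Query.{u}} (hQ : L.Definable Q) {N : ℕ} {T : TreeModel.{u}}
    {x : T.W} (h : Q.ascent N T x) : T.HasAncestors N x := by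
  induction N generalizing T x with
  | zero => trivial
  | succ N ih =>
    obtain ⟨hx1, hne⟩ := h
    set A := (Q.ascent N).ascentDomain with hA
    by_contra hcon
    have hxA : A T x := by
      by_contra hxA
      exact hne (iff_of_false (fun h => hxA h.1) fun h => hxA h.1.2)
    set U := T.update 0 {m | A T m} with hU
    have hUV : U.V 0 = {m | A T m} := T.update_V_self _ _
    have hsub : U.subtreeSet x 0 ⊆ U.V 0 := TreeModel.subtreeSet_subset (by rw [hUV]; exact hxA)
    have hdisj : ∀ z ∈ U.subtreeSet x 0, z ∉ T.V 1 := by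
      intro z hz hz1
      have hzA : A T z := by have := hsub hz; rwa [hUV] at this
      -- A path in the component cannot climb above z, because the parent of z has a child in the
      -- letter 1 and is thus outside the domain.
      have hdown : ∀ y, ReflTransGen (U.Adj 0) z y → ReflTransGen T.R z y := by
        intro y hy
        induction hy with
        | refl => exact .refl
        | @tail b c _ hbc ihb =>
          rcases hbc.1 with h | h
          · exact ihb.tail h
          · rcases ReflTransGen.cases_tail ihb with rfl | ⟨d, hd, hdb⟩
            · have hcA : A T c := by have := hbc.2.2; rwa [hUV] at this
              exact absurd hz1 (hcA.2.1 _ h)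
            · rwa [T.parent_unique (show T.R c b from h) hdb]
      have hzx := hdown x (U.adj_reflTransGen_symm hz)
      refine hcon ⟨z, ?_, ?_⟩
      · rcases reflTransGen_iff_eq_or_transGen.1 hzx with h | h
        · exact absurd (h ▸ hz1) hx1
        · exact h
      · exact TreeModel.HasAncestors.of_restrict (S := T.subtreeSet z 2)
          (hS := T.isTree_subtreeSet z 2) (x := ⟨z, .refl⟩)
          (TreeModel.HasAncestors.of_rename (ih (hzA.2.2 hz1).2))
    refine hne (Query.within_congr (iff_and_self.2 fun _ => hx1) ?_ hL hQ fun i => Nat.succ_ne_zero _)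
    change U.subtreeSet x 0 = _
    set U' := T.update 0 {m | m ∉ T.V 1 ∧ A T m} with hU'
    have hUV' : U'.V 0 = {m | m ∉ T.V 1 ∧ A T m} := T.update_V_self _ _
    ext y
    constructor
    · intro hy
      induction (show ReflTransGen (U.Adj 0) x y from hy) with
      | refl => exact .refl
      | @tail b c hb hbc ihb =>
        refine ReflTransGen.tail (ihb hb) ⟨hbc.1, ?_, ?_⟩
        · rw [hUV']; have := hbc.2.1; rw [hUV] at this; exact ⟨hdisj b hb, this⟩
        · rw [hUV']; have := hbc.2.2; rw [hUV] at this; exact ⟨hdisj c hy, this⟩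
    · intro hy
      refine ReflTransGen.mono (p := U.Adj 0) (r := U'.Adj 0)
        (fun a b h => ⟨h.1, ?_, ?_⟩) x y hy
      · rw [hUV]; have := h.2.1; rw [hUV'] at this; exact this.2
      · rw [hUV]; have := h.2.2; rw [hUV'] at this; exact this.2

/-- If `Q` changes at `n` when the submodel generated by `a` is replaced by the one generated by a
child `c` of `a`, then the properties `Q.ascent N` are finitely satisfiable. -/
theorem exists_ascent {Q : Query.{u}} (hQ : L.Definable Q) {T : TreeModel.{u}} {a c n : T.W}
    (hac : T.R a c) (hcn : ReflTransGen T.R c n)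
    (hne : ¬ (Q (T.generated a) ⟨n, .head hac hcn⟩ ↔ Q (T.generated c) ⟨n, hcn⟩)) (M : ℕ) :
    ∃ (S : TreeModel.{u}) (x : S.W), ∀ N ≤ M, Q.ascent N S x := by
  induction M with
  | zero => exact ⟨T, n, fun N hN => by obtain rfl := Nat.le_zero.1 hN; trivial⟩
  | succ M ih =>
    obtain ⟨A, m, hA⟩ := ih
    let B := T.generated a
    let r : B.W := T.generatedPoint a
    have hr : ∀ x : B.W, ReflTransGen B.R r x := by
      rintro ⟨x, hx⟩
      induction (show ReflTransGen T.R a x from hx) with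
      | refl => exact .refl
      | tail hb hbc ih => exact (ih hb).tail hbc
    let e := TreeModel.glueMap m r
    have he : Function.Injective e := TreeModel.glueMap_injective m r
    -- The letters 0, 1, 2 mark the copy of B, the gluing point and the copy of A. The odd letters
    -- from 3 on store the valuation of B and the even ones from 4 on that of A.
    let V : PropLetter → Set (A.W ⊕ {b : B.W // b ≠ r})
      | 0 => Set.range e
      | 1 => {.inl m}
      | 2 => Set.range Sum.inl
      | k + 3 => if k % 2 = 0 then e '' B.V (k / 2) else Sum.inl '' A.V (k / 2)
    have hV3 : ∀ i : ℕ, V (2 * i + 3) = e '' B.V i := fun i => by simp [V]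
    have hV4 : ∀ i : ℕ, V (2 * i + 4) = Sum.inl '' A.V i := fun i => by
      change (if (2 * i + 1) % 2 = 0 then _ else Sum.inl '' A.V ((2 * i + 1) / 2)) = _
      rw [if_neg (by omega), show (2 * i + 1) / 2 = i by omega]
    let S := A.glue B m r hr V
    have heR : ∀ x y, B.R x y ↔ S.R (e x) (e y) := TreeModel.glueRel_glueMap m hr
    have her : e r = .inl m := TreeModel.glueMap_root m r
    have hinl : ∀ b x, S.R (e b) (.inl x) → ¬ x = m := by
      intro b x h hx
      subst hx
      rw [← her, ← heR] at h
      exact B.not_transGen_self r (TransGen.tail' (hr b) h)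
    -- One tree must serve all stages at once: the domain is the copy of B for each N ≤ M, since m
    -- has all these properties in A.
    have hdom : ∀ N ≤ M, {y | (Q.ascent N).ascentDomain S y} = Set.range e := by
      intro N hN
      refine Set.Subset.antisymm (fun y hy => hy.1) ?_
      rintro _ ⟨b, rfl⟩
      refine ⟨⟨b, rfl⟩, fun y hy hy1 => ?_, fun h1 => ?_⟩
      · obtain rfl : y = .inl m := hy1
        exact hinl b m hy rfl
      · obtain h1 : e b = .inl m := h1
        rw [h1]
        refine ⟨⟨m, rfl⟩, ?_⟩
        refine (hL.subtree_iff (hL.definable_ascent hQ N) (T' := S) (p := 2) (2 * · + 4) Sum.inl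
          Sum.inl_injective (fun _ _ => Iff.rfl) (fun i x => ?_) (fun x => ⟨x, rfl⟩)
          (fun x y _ hy => hy) m (.inl m) rfl).1 (hA N hN)
        change x ∈ A.V i ↔ Sum.inl x ∈ V (2 * i + 4)
        rw [hV4, Sum.inl_injective.mem_set_image]
    have hne' : ∀ b : B.W, b ≠ r → e b ≠ .inl m := fun b hb h => hb (he (h.trans her.symm))
    let i : (T.generated c).W → B.W := fun x => ⟨x.1, .head hac x.2⟩
    have hir : ∀ x, i x ≠ r := fun x h =>
      T.not_transGen_self a (TransGen.head' hac
        (cast (congrArg (ReflTransGen T.R c) (congrArg Subtype.val h : x.1 = a)) x.2))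
    let n' : (T.generated c).W := ⟨n, hcn⟩
    refine ⟨S, e (i n'), ?_⟩
    rintro (_ | N) hN
    · trivial
    have hD := hdom N (by omega)
    have hDm : ∀ b, (Q.ascent N).ascentDomain S (e b) := fun b => hD.ge ⟨b, rfl⟩
    have hVe : ∀ j x, x ∈ B.V j ↔ e x ∈ S.V (2 * j + 3) := fun j x => by
      change x ∈ B.V j ↔ e x ∈ V (2 * j + 3)
      rw [hV3, he.mem_set_image]
    refine ⟨hne' _ (hir n'), ?_⟩
    -- The two sides compared in `Query.ascent` become Q at n in `T.generated a` and in `T.generated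
    -- c`: once the glued root a is deleted, the component of n is the copy of the tree below c.
    have h1 : Q.within (2 * · + 3) (Q.ascent N).ascentDomain S (e (i n')) ↔ Q B (i n') := by
      refine (and_iff_right (hDm _)).trans
        (hL.subtree_iff hQ (T' := S.update 0 {y | (Q.ascent N).ascentDomain S y}) (p := 0)
          (2 * · + 3) e he heR (fun j x => ?_) (fun x => ?_) (fun x y _ hy => ?_) _ _ rfl).symm
      · rw [TreeModel.update_V_of_ne _ _ (Nat.succ_ne_zero _)]
        exact hVe j x
      · rw [TreeModel.update_V_self]
        exact hDm x
      · rw [TreeModel.update_V_self, hD] at hy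
        exact hy
    have h2 : Q.within (2 * · + 3) (fun T x => x ∉ T.V 1 ∧ (Q.ascent N).ascentDomain T x) S
        (e (i n')) ↔ Q (T.generated c) n' := by
      refine (and_iff_right ⟨hne' _ (hir n'), hDm _⟩).trans
        (hL.subtree_iff hQ
          (T' := S.update 0 {y | y ∉ S.V 1 ∧ (Q.ascent N).ascentDomain S y}) (p := 0)
          (2 * · + 3) (e ∘ i) (he.comp fun x y h => ?_) (fun x y => ?_) (fun j x => ?_)
          (fun x => ?_) (fun x y hxy hy => ?_) _ _ rfl).symm
      · exact Subtype.ext (Subtype.mk.inj h)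
      · exact heR (i x) (i y)
      · rw [TreeModel.update_V_of_ne _ _ (Nat.succ_ne_zero _)]
        exact hVe j (i x)
      · rw [TreeModel.update_V_self]
        exact ⟨hne' _ (hir x), hDm _⟩
      · rw [TreeModel.update_V_self] at hy
        obtain ⟨b, rfl⟩ := hD.le hy.2
        have hbr : b ≠ r := fun h => hy.1 (by rw [h, her]; rfl)
        have hb : ReflTransGen T.R c b.1 := by
          rcases hxy with h | h
          · exact x.2.tail ((heR (i x) b).2 h)
          · have h' : T.R b.1 x.1 := (heR b (i x)).2 h
            rcases ReflTransGen.cases_tail x.2 with hx | ⟨d, hd, hdx⟩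
            · rw [hx] at h'
              exact absurd (Subtype.ext (T.parent_unique h' hac)) hbr
            · rwa [T.parent_unique h' hdx]
        exact ⟨⟨b.1, hb⟩, rfl⟩
    rw [h1, h2]
    exact hne

theorem generated_child_iff (hc : L.Compactness) {Q : Query.{u}} (hQ : L.Definable Q)
    {T : TreeModel.{u}} {a c n : T.W} (hac : T.R a c) (hcn : ReflTransGen T.R c n) :
    Q (T.generated a) ⟨n, .head hac hcn⟩ ↔ Q (T.generated c) ⟨n, hcn⟩ := by
  by_contra hne
  obtain ⟨Γ, ⟨S, x, hS⟩, hΓ⟩ := hc.exists_forall (hL.definable_ascent hQ)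
    (hL.exists_ascent hQ hac hcn hne)
  obtain ⟨N, hN⟩ := S.exists_not_hasAncestors x
  exact hN (hL.hasAncestors_of_ascent hQ (hΓ S x hS N))

theorem generated_iff_generated (hc : L.Compactness) {Q : Query.{u}} (hQ : L.Definable Q)
    {T : TreeModel.{u}} {a n : T.W} (han : ReflTransGen T.R a n) :
    Q (T.generated a) ⟨n, han⟩ ↔ Q (T.generated n) (T.generatedPoint n) := by
  induction han using ReflTransGen.head_induction_on with
  | refl => exact Iff.rfl
  | head hac hcn ih => exact (hL.generated_child_iff hc hQ hac hcn).trans ih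

/-- In a logic with compactness, definable properties are invariant for generated submodels. -/
theorem generated_iff (hc : L.Compactness) {Q : Query.{u}} (hQ : L.Definable Q)
    (T : TreeModel.{u}) (n : T.W) : Q T n ↔ Q (T.generated n) (T.generatedPoint n) := by
  obtain ⟨r, -, hr, -⟩ := T.isTree
  rw [← hL.generated_iff_generated hc hQ (hr n)]
  exact hL.restrict_iff' hQ (T.isTree_generatedSet r) id Function.injective_id
    (fun _ _ => Iff.rfl) (fun _ _ => Iff.rfl)
    (Set.range_id.trans (Set.eq_univ_of_forall hr).symm) n _ rfl

end TreeLogic.IsModalExtension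
end GMLTrees

/-! ### Types, levels and graded bisimulations -/

namespace GMLTrees

open Relation

namespace GMLFormula

theorem exists_conj {ι : Type*} {s : Set ι} (hs : s.Finite) (f : ι → GMLFormula) :
    ∃ χ : GMLFormula, ∀ (T : TreeModel.{u}) (w : T.W),
      χ.Sat T w ↔ ∀ i ∈ s, (f i).Sat T w := by
  induction s, hs using Set.Finite.induction_on with
  | empty => exact ⟨.neg .bot, fun T w => by simp [Sat]⟩
  | @insert a s _ _ ih =>
    obtain ⟨χ, hχ⟩ := ih
    exact ⟨.and (f a) χ, fun T w => by simp [Sat, hχ]⟩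

theorem exists_disj {ι : Type*} {s : Set ι} (hs : s.Finite) (f : ι → GMLFormula) :
    ∃ χ : GMLFormula, ∀ (T : TreeModel.{u}) (w : T.W),
      χ.Sat T w ↔ ∃ i ∈ s, (f i).Sat T w := by
  obtain ⟨χ, hχ⟩ := exists_conj.{u} hs fun i => .neg (f i)
  exact ⟨.neg χ, fun T w => by simp [Sat, hχ]⟩

end GMLFormula

/-- The formulas in `F` that are true at `w`. -/
def TreeModel.truths (T : TreeModel.{u}) (F : Set GMLFormula) (w : T.W) : Set GMLFormula :=
  {α ∈ F | α.Sat T w}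

theorem TreeModel.truths_eq_iff {T T' : TreeModel.{u}} {F : Set GMLFormula} {w : T.W} {w' : T'.W} :
    T.truths F w = T'.truths F w' ↔ ∀ α ∈ F, α.Sat T w ↔ α.Sat T' w' := by
  simp only [truths, Set.ext_iff, Set.mem_ofPred_eq]
  exact forall_congr' fun α => by tauto

theorem GMLFormula.exists_truths_eq {F : Set GMLFormula} (hF : F.Finite) (τ : Set GMLFormula) :
    ∃ χ : GMLFormula, ∀ (T : TreeModel.{u}) (w : T.W), χ.Sat T w ↔ T.truths F w = τ := by
  classical
  by_cases hτ : τ ⊆ F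
  · obtain ⟨χ, hχ⟩ := exists_conj.{u} hF fun α => if α ∈ τ then α else .neg α
    refine ⟨χ, fun T w => ?_⟩
    rw [hχ]
    constructor
    · intro h
      ext α
      by_cases hα : α ∈ τ
      · have := h α (hτ hα)
        rw [if_pos hα] at this
        exact iff_of_true ⟨hτ hα, this⟩ hα
      · refine iff_of_false (fun h' => ?_) hα
        have := h α h'.1
        rw [if_neg hα] at this
        exact this h'.2
    · rintro rfl α hα
      split_ifs with h
      · exact h.2
      · exact fun h' => h ⟨hα, h'⟩
  · refine ⟨.bot, fun T w => iff_of_false id ?_⟩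
    rintro rfl
    exact hτ fun α hα => hα.1

namespace TreeModel

/-- `x` can be reached from `n` in exactly `i` steps. -/
def Level (T : TreeModel.{u}) : ℕ → T.W → T.W → Prop
  | 0, n, x => n = x
  | i + 1, n, x => ∃ b, T.Level i n b ∧ T.R b x

theorem Level.reflTransGen {T : TreeModel.{u}} {i : ℕ} {n x : T.W} (h : T.Level i n x) :
    ReflTransGen T.R n x := by
  induction i generalizing x with
  | zero => exact h ▸ .refl
  | succ i ih =>
    obtain ⟨b, hb, hbx⟩ := h
    exact (ih hb).tail hbx

theorem exists_level {T : TreeModel.{u}} {n x : T.W} (h : ReflTransGen T.R n x) :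
    ∃ i, T.Level i n x := by
  induction h with
  | refl => exact ⟨0, rfl⟩
  | tail _ h ih =>
    obtain ⟨i, hi⟩ := ih
    exact ⟨i + 1, _, hi, h⟩

theorem Level.trans {T : TreeModel.{u}} {i j : ℕ} {x y z : T.W} (h : T.Level i x y)
    (h' : T.Level j y z) : T.Level (i + j) x z := by
  induction j generalizing z with
  | zero => exact h' ▸ h
  | succ j ih =>
    obtain ⟨b, hb, hbx⟩ := h'
    exact ⟨b, ih hb, hbx⟩

theorem level_one {T : TreeModel.{u}} {x y : T.W} (h : T.R x y) : T.Level 1 x y :=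
  ⟨x, rfl, h⟩

theorem Level.unique {T : TreeModel.{u}} {i j : ℕ} {n x : T.W} (h : T.Level i n x)
    (h' : T.Level j n x) : i = j := by
  have hno : ∀ i, ¬ T.Level (i + 1) n n := by
    rintro i ⟨b, hb, hbn⟩
    exact T.not_transGen_self n (TransGen.tail' hb.reflTransGen hbn)
  induction i generalizing j x with
  | zero =>
    obtain rfl : n = x := h
    cases j with
    | zero => rfl
    | succ j => exact absurd h' (hno j)
  | succ i ih =>
    cases j with
    | zero =>
      obtain rfl : n = x := h'
      exact absurd h (hno i)
    | succ j =>
      obtain ⟨b, hb, hbx⟩ := h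
      obtain ⟨b', hb', hbx'⟩ := h'
      obtain rfl := T.parent_unique hbx hbx'
      rw [ih hb hb']

theorem Level.source_unique {T : TreeModel.{u}} {i : ℕ} {n n' x : T.W} (h : T.Level i n x)
    (h' : T.Level i n' x) : n = n' := by
  induction i generalizing x with
  | zero => exact Eq.trans h (Eq.symm h')
  | succ i ih =>
    obtain ⟨b, hb, hbx⟩ := h
    obtain ⟨b', hb', hbx'⟩ := h'
    obtain rfl := T.parent_unique hbx hbx'
    exact ih hb hb'

/-- The children of a node in a component of a letter are its children that satisfy the letter. -/
def subtreeChildren (T : TreeModel.{u}) {n : T.W} {p : PropLetter} (hn : n ∈ T.V p)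
    (y : (T.subtree n p).W) :
    {c // (T.subtree n p).R y c} ≃ {c | T.R y.1 c ∧ c ∈ T.V p} where
  toFun c := ⟨c.1.1, c.2, subtreeSet_subset hn c.1.2⟩
  invFun c := ⟨⟨c.1, ReflTransGen.tail y.2 ⟨.inl c.2.1, subtreeSet_subset hn y.2, c.2.2⟩⟩, c.2.1⟩
  left_inv _ := rfl
  right_inv _ := rfl

/-- Graded formulas only look downwards, so it is enough that no descendant of c is lost. -/
theorem sat_subtree_iff {T : TreeModel.{u}} {n : T.W} {p : PropLetter} (hn : n ∈ T.V p)
    (ρ : PropLetter → PropLetter) (α : GMLFormula) (c : (T.subtree n p).W)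
    (hc : ∀ x, ReflTransGen T.R c.1 x → x ∈ T.V p) :
    α.Sat ((T.subtree n p).rename ρ) c ↔ α.Sat (T.rename ρ) c.1 := by
  induction α generalizing c with
  | letter i => exact Iff.rfl
  | bot => exact Iff.rfl
  | neg α ih => exact not_congr (ih c hc)
  | and α β ihα ihβ => exact and_congr (ihα c hc) (ihβ c hc)
  | dia k α ih =>
    have h : {m | T.R c.1 m ∧ α.Sat (T.rename ρ) m} = Subtype.val ''
        {m : (T.subtree n p).W | T.R c.1 m.1 ∧ α.Sat ((T.subtree n p).rename ρ) m} := by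
      ext m
      constructor
      · rintro ⟨h1, h2⟩
        have hd := ((T.subtreeChildren hn c).symm ⟨m, h1, hc m (.single h1)⟩).1.2
        exact ⟨⟨m, hd⟩, ⟨h1, (ih ⟨m, hd⟩ fun x hx => hc x (.head h1 hx)).2 h2⟩, rfl⟩
      · rintro ⟨m, ⟨h1, h2⟩, rfl⟩
        exact ⟨h1, (ih m fun x hx => hc x (.head h1 hx)).1 h2⟩
    change (k : ℕ∞) ≤ _ ↔ (k : ℕ∞) ≤ Set.encard {m | T.R c.1 m ∧ α.Sat (T.rename ρ) m}
    rw [h, Subtype.val_injective.encard_image]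
    exact Iff.rfl

end TreeModel

/-- A graded bisimulation: related nodes satisfy the same letters, and there is a bijection between
their children that respects the relation. -/
def IsGradedBisimulation (T T' : TreeModel.{u}) (Z : T.W → T'.W → Prop) : Prop :=
  ∀ x y, Z x y → (∀ i, x ∈ T.V i ↔ y ∈ T'.V i) ∧
    ∃ e : {c // T.R x c} ≃ {c // T'.R y c}, ∀ c, Z c.1 (e c).1

section

variable {T T' : TreeModel.{u}} {Z : T.W → T'.W → Prop}

/-- The graph of the isomorphism that a graded bisimulation between trees induces. -/
inductive BisimGraph (e : ∀ x y, Z x y → {c // T.R x c} ≃ {c // T'.R y c}) (n : T.W) (n' : T'.W) :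
    T.W → T'.W → Prop
  | root : BisimGraph e n n' n n'
  | step {x y} (h : BisimGraph e n n' x y) (hZ : Z x y) (c : {c // T.R x c}) :
      BisimGraph e n n' c.1 (e x y hZ c).1

variable {e : ∀ x y, Z x y → {c // T.R x c} ≃ {c // T'.R y c}} {n : T.W} {n' : T'.W}

theorem BisimGraph.reach {x : T.W} {y : T'.W} (h : BisimGraph e n n' x y) :
    ReflTransGen T.R n x ∧ ReflTransGen T'.R n' y := by
  induction h with
  | root => exact ⟨.refl, .refl⟩
  | step _ hZ c ih => exact ⟨ih.1.tail c.2, ih.2.tail (e _ _ hZ c).2⟩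

/-- Parents are unique, so the path from n to x, and with it the sequence of bijections applied, is
forced. -/
theorem BisimGraph.right_unique {x : T.W} {y : T'.W} (h : BisimGraph e n n' x y) {y' : T'.W}
    (h' : BisimGraph e n n' x y') : y = y' := by
  induction h generalizing y' with
  | root =>
    generalize hx : n = x at h'
    cases h' with
    | root => rfl
    | @step x₁ y₁ h₁ hZ₁ c₁ =>
      exact absurd (TransGen.tail' h₁.reach.1 c₁.2) (T.not_transGen_self _)
  | @step x y h hZ c ih =>
    generalize hx : c.1 = x' at h'
    cases h' with
    | root => exact absurd (TransGen.tail' h.reach.1 (hx ▸ c.2)) (T.not_transGen_self n)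
    | @step x₁ y₁ h₁ hZ₁ c₁ =>
      obtain rfl : x = x₁ := T.parent_unique c.2 (hx ▸ c₁.2)
      obtain rfl := ih h₁
      obtain rfl : c = c₁ := Subtype.ext hx
      rfl

theorem BisimGraph.left_unique {x : T.W} {y : T'.W} (h : BisimGraph e n n' x y) {x' : T.W}
    (h' : BisimGraph e n n' x' y) : x = x' := by
  induction h generalizing x' with
  | root =>
    generalize hx : n' = y at h'
    cases h' with
    | root => rfl
    | @step x₁ y₁ h₁ hZ₁ c₁ =>
      exact absurd (TransGen.tail' h₁.reach.2 (e _ _ hZ₁ c₁).2) (T'.not_transGen_self _)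
  | @step x y h hZ c ih =>
    generalize hx : (e x y hZ c).1 = y' at h'
    cases h' with
    | root =>
      exact absurd (TransGen.tail' h.reach.2 (hx ▸ (e _ _ hZ c).2)) (T'.not_transGen_self n')
    | @step x₁ y₁ h₁ hZ₁ c₁ =>
      obtain rfl : y = y₁ := T'.parent_unique (e _ _ hZ c).2 (hx ▸ (e _ _ hZ₁ c₁).2)
      obtain rfl := ih h₁
      obtain rfl : c = c₁ := (e x y hZ).injective (Subtype.ext hx)
      rfl

/-- A graded bisimulation between trees induces an isomorphism of generated submodels. -/
theorem IsGradedBisimulation.exists_iso (hZ : IsGradedBisimulation T T' Z) (hn : Z n n') :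
    ∃ i : (T.generated n).Iso (T'.generated n'),
      i.toEquiv (T.generatedPoint n) = T'.generatedPoint n' := by
  choose hV e he using hZ
  have hGZ : ∀ {x y}, BisimGraph e n n' x y → Z x y := by
    intro x y h
    induction h with
    | root => exact hn
    | step _ hZ c _ => exact he _ _ hZ c
  have hl : ∀ x : (T.generated n).W, ∃ y : (T'.generated n').W, BisimGraph e n n' x.1 y.1 := by
    rintro ⟨x, hx⟩
    induction (show ReflTransGen T.R n x from hx) with
    | refl => exact ⟨⟨n', .refl⟩, .root⟩
    | @tail b c hb hbc ih =>
      obtain ⟨y, hy⟩ := ih hb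
      have h := BisimGraph.step hy (hGZ hy) ⟨c, hbc⟩
      exact ⟨⟨_, h.reach.2⟩, h⟩
  have hr : ∀ y : (T'.generated n').W, ∃ x : (T.generated n).W, BisimGraph e n n' x.1 y.1 := by
    rintro ⟨y, hy⟩
    induction (show ReflTransGen T'.R n' y from hy) with
    | refl => exact ⟨⟨n, .refl⟩, .root⟩
    | @tail b c hb hbc ih =>
      obtain ⟨x, hx⟩ := ih hb
      have h := BisimGraph.step hx (hGZ hx) ((e _ _ (hGZ hx)).symm ⟨c, hbc⟩)
      rw [Equiv.apply_symm_apply] at h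
      exact ⟨⟨_, h.reach.1⟩, h⟩
  choose f hf using hl
  have hbij : Function.Bijective f := by
    refine ⟨fun x y h => Subtype.ext ((hf x).left_unique (h ▸ hf y)), fun y => ?_⟩
    obtain ⟨x, hx⟩ := hr y
    exact ⟨x, Subtype.ext ((hf x).right_unique hx)⟩
  refine ⟨⟨Equiv.ofBijective f hbij, fun x y => ⟨fun h => ?_, fun h => ?_⟩,
    fun p x => hV _ _ (hGZ (hf x)) p⟩, Subtype.ext ((hf _).right_unique .root)⟩
  · have h' := (hf y).right_unique (BisimGraph.step (hf x) (hGZ (hf x)) ⟨y.1, h⟩)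
    change T'.R (f x).1 (f y).1
    rw [h']
    exact (e _ _ (hGZ (hf x)) ⟨y.1, h⟩).2
  · have h2 := BisimGraph.step (hf x) (hGZ (hf x)) ((e _ _ (hGZ (hf x))).symm ⟨(f y).1, h⟩)
    rw [Equiv.apply_symm_apply] at h2
    have h' := (hf y).left_unique h2
    change T.R x.1 y.1
    rw [h']
    exact ((e _ _ (hGZ (hf x))).symm ⟨(f y).1, h⟩).2

end

/-- Compactness enters only through invariance for generated submodels; the rest is isomorphism
invariance. -/
theorem TreeLogic.IsModalExtension.bisimulation_iff {L : TreeLogic.{u, v}}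
    (hL : L.IsModalExtension) (hc : L.Compactness) {Q : Query.{u}} (hQ : L.Definable Q)
    {T T' : TreeModel.{u}} {Z : T.W → T'.W → Prop} (hZ : IsGradedBisimulation T T' Z)
    {n : T.W} {n' : T'.W} (hn : Z n n') : Q T n ↔ Q T' n' := by
  obtain ⟨i, hi⟩ := hZ.exists_iso hn
  rw [hL.generated_iff hc hQ T, hL.generated_iff hc hQ T', hL.iso_iff hQ i, hi]

/-- `w` and `w'` look the same down to depth `j`, where only the letters below `m` are considered
above depth `j`, and the formulas in `F` at depth `j`. -/
def Similar (F : Set GMLFormula) (m : ℕ) :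
    ℕ → (T : TreeModel.{u}) → T.W → (T' : TreeModel.{u}) → T'.W → Prop
  | 0, T, w, T', w' => T.truths F w = T'.truths F w'
  | j + 1, T, w, T', w' => (∀ i < m, w ∈ T.V i ↔ w' ∈ T'.V i) ∧
      ∃ e : {c // T.R w c} ≃ {c // T'.R w' c}, ∀ c, Similar F m j T c.1 T' (e c).1

end GMLTrees

/-! ### Dependence on finitely many letters and a finite depth -/

namespace GMLTrees

open Relation

/-- The proposition letters below `m`. -/
def lettersBelow (m : ℕ) : Set GMLFormula := GMLFormula.letter '' Set.Iio m

theorem lettersBelow_finite (m : ℕ) : (lettersBelow m).Finite :=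
  (Set.finite_Iio m).image _

theorem Similar.letter_iff {F : Set GMLFormula} {m j : ℕ} (hF : lettersBelow m ⊆ F)
    {T T' : TreeModel.{u}} {w : T.W} {w' : T'.W} (h : Similar F m j T w T' w') {i : ℕ}
    (hi : i < m) : w ∈ T.V i ↔ w' ∈ T'.V i := by
  cases j with
  | zero => exact TreeModel.truths_eq_iff.1 h (.letter i) (hF ⟨i, hi, rfl⟩)
  | succ j => exact h.1 i hi

/-- The nodes of `T` up to depth `N` below `n`, in the letter `0`; the letters of `T`, with odd
index; and the first `N` letters of `T`, with even index. -/
def TreeModel.truncation (T : TreeModel.{u}) (N : ℕ) (n : T.W) : TreeModel.{u} :=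
  T.withValuation fun
    | 0 => {x | ∃ i ≤ N, T.Level i n x}
    | k + 1 => {x | if k % 2 = 0 then x ∈ T.V (k / 2) else x ∈ T.V (k / 2) ∧ k / 2 < N}

theorem TreeModel.truncation_odd (T : TreeModel.{u}) (N : ℕ) (n : T.W) (j : ℕ) :
    (T.truncation N n).V (2 * j + 1) = T.V j := by
  change {x | if 2 * j % 2 = 0 then x ∈ T.V (2 * j / 2) else x ∈ T.V (2 * j / 2) ∧ 2 * j / 2 < N} = _
  simp

theorem TreeModel.truncation_even (T : TreeModel.{u}) (N : ℕ) (n : T.W) (j : ℕ) :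
    (T.truncation N n).V (2 * j + 2) = {x | x ∈ T.V j ∧ j < N} := by
  change {x | if (2 * j + 1) % 2 = 0 then x ∈ T.V ((2 * j + 1) / 2) else
    x ∈ T.V ((2 * j + 1) / 2) ∧ (2 * j + 1) / 2 < N} = _
  have h1 : (2 * j + 1) % 2 = 1 := by omega
  have h2 : (2 * j + 1) / 2 = j := by omega
  simp [h1, h2]

theorem TreeModel.level_withValuation {T : TreeModel.{u}} {V : PropLetter → Set T.W} {i : ℕ}
    {n x : T.W} : (T.withValuation V).Level i n x ↔ T.Level i n x := by
  induction i generalizing x with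
  | zero => exact Iff.rfl
  | succ i ih => exact exists_congr fun b => and_congr_left' ih

namespace TreeLogic.IsModalExtension

variable {L : TreeLogic.{u, v}} (hL : L.IsModalExtension)
include hL

theorem definable_forall_level {P : Query.{u}} (hP : L.Definable P) (i : ℕ) :
    L.Definable fun T n => ∀ x, T.Level i n x → P T x := by
  induction i generalizing P with
  | zero =>
    obtain ⟨φ, hφ⟩ := hP
    exact ⟨φ, fun T n => (hφ T n).trans ⟨fun h x hx => hx ▸ h, fun h => h n rfl⟩⟩
  | succ i ih =>
    obtain ⟨φ, hφ⟩ := ih (hL.definable_box hP)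
    exact ⟨φ, fun T n => (hφ T n).trans
      ⟨fun h x ⟨b, hb, hbx⟩ => h b hb x hbx, fun h b hb x hbx => h x ⟨b, hb, hbx⟩⟩⟩

/-- With compactness, the truth of a definable property depends on finitely many letters and on a
finite depth. -/
theorem exists_finite_vision (hc : L.Compactness) {Q : Query.{u}} (hQ : L.Definable Q) :
    ∃ N, ∀ (U : TreeModel.{u}) (n : U.W),
      (∀ i ≤ N, ∀ x, U.Level i n x →
        x ∈ U.V 0 ∧ ∀ j < N, (x ∈ U.V (2 * j + 1) ↔ x ∈ U.V (2 * j + 2))) →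
      (Q (U.rename (2 * · + 1)) n ↔
        Q ((U.subtree n 0).rename (2 * · + 2)) (U.subtreePoint n 0)) := by
  by_contra! hcon
  let good : ℕ → Query.{u} := fun N U n =>
    (∀ i ≤ N, ∀ x, U.Level i n x →
        x ∈ U.V 0 ∧ ∀ j < N, (x ∈ U.V (2 * j + 1) ↔ x ∈ U.V (2 * j + 2)))
  let P : ℕ → Query.{u} := fun N U n => good N U n ∧
    ¬ (Q (U.rename (2 * · + 1)) n ↔
      n ∈ U.V 0 ∧ Q ((U.subtree n 0).rename (2 * · + 2)) (U.subtreePoint n 0))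
  have hgood : ∀ N, L.Definable (good N) := fun N =>
    hL.definable_forall_mem (Set.finite_Iic N) fun i _ => hL.definable_forall_level
      (hL.definable_and (hL.definable_letter 0) (hL.definable_forall_mem (Set.finite_Iio N)
        fun j _ => hL.definable_iff (hL.definable_letter _) (hL.definable_letter _))) i
  have hP : ∀ N, L.Definable (P N) := fun N =>
    hL.definable_and (hgood N) (hL.definable_not (hL.definable_iff (hL.definable_rename hQ _)
      (hL.definable_subtree (hL.definable_rename hQ _) 0)))
  have hfin : ∀ N, ∃ (U : TreeModel.{u}) (n : U.W), ∀ i ≤ N, P i U n := by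
    intro N
    obtain ⟨U, n, hg, hne⟩ := hcon N
    refine ⟨U, n, fun i hi => ⟨fun k hk x hx => ?_, ?_⟩⟩
    · obtain ⟨h1, h2⟩ := hg k (hk.trans hi) x hx
      exact ⟨h1, fun j hj => h2 j (hj.trans_le hi)⟩
    · rw [and_iff_right (hg 0 (Nat.zero_le _) n rfl).1]
      tauto
  obtain ⟨Γ, ⟨U, n, hU⟩, hΓ⟩ := hc.exists_forall hP hfin
  have hall := hΓ U n hU
  have hmem : ∀ x, ReflTransGen U.R n x → x ∈ U.V 0 ∧
      ∀ j, (x ∈ U.V (2 * j + 1) ↔ x ∈ U.V (2 * j + 2)) := by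
    intro x hx
    obtain ⟨i, hi⟩ := TreeModel.exists_level hx
    refine ⟨((hall i).1 i le_rfl x hi).1, fun j => ?_⟩
    exact ((hall (max i (j + 1))).1 i (le_max_left _ _) x hi).2 j
      (Nat.lt_of_succ_le (le_max_right _ _))
  have hn := (hmem n .refl).1
  refine (hall 0).2 ?_
  rw [and_iff_right hn]
  -- In the limit model the two valuations agree below n and nothing there is dropped. The nodes
  -- above n are uncontrolled, but a bisimulation does not see them.
  refine hL.bisimulation_iff hc hQ (T := U.rename (2 * · + 1))
    (T' := (U.subtree n 0).rename (2 * · + 2))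
    (Z := fun x (y : (U.subtree n 0).W) => x = y.1 ∧ ReflTransGen U.R n x) ?_ ⟨rfl, .refl⟩
  rintro _ y ⟨rfl, hx⟩
  refine ⟨(hmem _ hx).2, ⟨Equiv.trans (Equiv.subtypeEquivRight fun c => ?_)
    (U.subtreeChildren hn y).symm, fun c => ⟨rfl, hx.tail c.2⟩⟩⟩
  exact ⟨fun h => ⟨h, (hmem c (hx.tail h)).1⟩, fun h => h.1⟩

/-- With compactness, definable properties are invariant for similarity of a sufficient depth. -/
theorem exists_similar_lettersBelow (hc : L.Compactness) {Q : Query.{u}} (hQ : L.Definable Q) :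
    ∃ m k, ∀ (T : TreeModel.{u}) (n : T.W) (T' : TreeModel.{u}) (n' : T'.W),
      Similar (lettersBelow m) m k T n T' n' → (Q T n ↔ Q T' n') := by
  obtain ⟨N, hN⟩ := hL.exists_finite_vision hc hQ
  refine ⟨N, N, fun T n T' n' h => ?_⟩
  -- The truncation codes T in the odd letters and its cut-off version in the even ones, so the
  -- bound N makes the cut invisible to Q.
  have key : ∀ (T : TreeModel.{u}) (n : T.W), Q T n ↔
      Q (((T.truncation N n).subtree n 0).rename (2 * · + 2))
        ((T.truncation N n).subtreePoint n 0) := by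
    intro T n
    rw [← hN (T.truncation N n) n]
    · refine hL.iso_iff hQ (T := T) (T' := (T.truncation N n).rename (2 * · + 1))
        ⟨Equiv.refl T.W, fun _ _ => Iff.rfl, fun p x => ?_⟩ n
      change x ∈ T.V p ↔ x ∈ (T.truncation N n).V (2 * p + 1)
      rw [TreeModel.truncation_odd]
      exact Iff.rfl
    · intro i hi x hx
      refine ⟨⟨i, hi, TreeModel.level_withValuation.1 hx⟩, fun j hj => ?_⟩
      rw [TreeModel.truncation_odd, TreeModel.truncation_even]
      exact ⟨fun h => ⟨h, hj⟩, fun h => h.1⟩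
  rw [key T n, key T' n']
  have hroot : ∀ (T : TreeModel.{u}) (n : T.W), n ∈ (T.truncation N n).V 0 := fun T n =>
    ⟨0, Nat.zero_le _, rfl⟩
  -- Here i is the depth already descended and j the depth left; at j = 0 the truncated trees have
  -- no further children to match.
  refine hL.bisimulation_iff hc hQ (T := ((T.truncation N n).subtree n 0).rename (2 * · + 2))
    (T' := ((T'.truncation N n').subtree n' 0).rename (2 * · + 2))
    (Z := fun (x : ((T.truncation N n).subtree n 0).W) (y : ((T'.truncation N n').subtree n' 0).W) =>
      ∃ i j, i + j = N ∧ T.Level i n x.1 ∧ T'.Level i n' y.1 ∧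
        Similar (lettersBelow N) N j T x.1 T' y.1) ?_ ⟨0, N, Nat.zero_add N, rfl, rfl, h⟩
  rintro x y ⟨i, j, hij, hx, hy, hxy⟩
  constructor
  · intro k
    change x.1 ∈ (T.truncation N n).V (2 * k + 2) ↔ y.1 ∈ (T'.truncation N n').V (2 * k + 2)
    rw [TreeModel.truncation_even, TreeModel.truncation_even]
    exact and_congr_left fun hk => hxy.letter_iff subset_rfl hk
  · cases j with
    | zero =>
      have hempty : ∀ (T : TreeModel.{u}) (n : T.W) (x : ((T.truncation N n).subtree n 0).W),
          T.Level i n x.1 → IsEmpty {c // ((T.truncation N n).subtree n 0).R x c} := by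
        intro T n x hx
        refine ⟨fun c => ?_⟩
        obtain ⟨k, hk, hc⟩ := TreeModel.subtreeSet_subset (hroot T n) c.1.2
        have := hc.unique (show T.Level (i + 1) n c.1.1 from ⟨x.1, hx, c.2⟩)
        omega
      have h1 := hempty T n x hx
      have h2 := hempty T' n' y hy
      exact ⟨@Equiv.equivOfIsEmpty _ _ h1 h2, fun c => h1.elim c⟩
    | succ j =>
      obtain ⟨-, e, he⟩ := hxy
      have hmem : ∀ (T : TreeModel.{u}) (n x : T.W), T.Level i n x → ∀ c,
          T.R x c ↔ T.R x c ∧ c ∈ (T.truncation N n).V 0 := fun T n x hx c =>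
        ⟨fun h => ⟨h, i + 1, by omega, x, hx, h⟩, fun h => h.1⟩
      refine ⟨((TreeModel.subtreeChildren _ (hroot T n) x).trans
        (Equiv.subtypeEquivRight fun c => (hmem T n x.1 hx c).symm)).trans <| e.trans <|
        (Equiv.subtypeEquivRight fun c => hmem T' n' y.1 hy c).trans
          (TreeModel.subtreeChildren _ (hroot T' n') y).symm, fun c => ?_⟩
      exact ⟨i + 1, j, by omega, ⟨x.1, hx, c.2⟩, ⟨y.1, hy, (e ⟨c.1.1, c.2⟩).2⟩,
        he ⟨c.1.1, c.2⟩⟩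

end TreeLogic.IsModalExtension
end GMLTrees

/-! ### Trading depth for counting formulas -/

namespace GMLTrees

open Relation

theorem exists_equiv_of_fibers {α : Type*} {β : Type*} {γ : Type*} {A : α → Prop} {B : β → Prop}
    (f : α → γ) (g : β → γ)
    (h : ∀ t, Nonempty ({a | A a ∧ f a = t} ≃ {b | B b ∧ g b = t})) :
    ∃ e : {a // A a} ≃ {b // B b}, ∀ a, g (e a).1 = f a.1 := by
  have k := fun t => (h t).some
  let i : ∀ t, {a : {a // A a} // f a.1 = t} ≃ {b : {b // B b} // g b.1 = t} := fun t =>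
    ((Equiv.subtypeSubtypeEquivSubtypeInter A fun a => f a = t).trans (k t)).trans
      (Equiv.subtypeSubtypeEquivSubtypeInter B fun b => g b = t).symm
  exact ⟨Equiv.ofFiberEquiv (f := fun a : {a // A a} => f a.1)
    (g := fun b : {b // B b} => g b.1) i, fun a => Equiv.ofFiberEquiv_map i a⟩

/-- Any two infinite subsets of a countable set are equinumerous. This is the reason why
Löwenheim–Skolem is needed. -/
theorem nonempty_equiv_of_forall_le_encard {α : Type*} [Countable α] {A B : Set α} (hBA : B ⊆ A)
    (h : (A \ B).Nonempty → ∀ k : ℕ, (k : ℕ∞) ≤ B.encard) : Nonempty (A ≃ B) := by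
  rcases (A \ B).eq_empty_or_nonempty with hAB | hAB
  · rw [Set.Subset.antisymm (Set.sdiff_eq_empty.1 hAB) hBA]
    exact ⟨Equiv.refl _⟩
  · have hB : B.Infinite := by
      rw [← Set.encard_eq_top_iff]
      exact ENat.eq_top_iff_forall_ge.2 (h hAB)
    have := hB.to_subtype
    have := (hB.mono hBA).to_subtype
    exact nonempty_equiv_of_countable

theorem nonempty_equiv_of_encard_eq {α β : Type*} {A : Set α} {B : Set β} {k : ℕ}
    (hA : A.encard ≤ k) (h : A.encard = B.encard) : Nonempty (A ≃ B) := by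
  have hA' : A.Finite := Set.encard_lt_top_iff.1 (hA.trans_lt (ENat.natCast_lt_top k))
  have hB' : B.Finite := Set.encard_lt_top_iff.1 (h ▸ hA.trans_lt (ENat.natCast_lt_top k))
  have := hA'.to_subtype
  have := hB'.to_subtype
  refine Finite.card_eq.1 ?_
  rw [Nat.card_coe_set_eq, Nat.card_coe_set_eq, Set.ncard_def, Set.ncard_def, h]

/-- The children of `w` at which exactly the formulas in `τ` are true, among those in `F`. -/
def TreeModel.childClass (T : TreeModel.{u}) (F : Set GMLFormula) (w : T.W) (τ : Set GMLFormula) :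
    Set T.W :=
  {c | T.R w c ∧ T.truths F c = τ}

/-- A set of children of every node that retains, of every class of children with respect to `F`,
as many as there are, up to `g`. -/
theorem TreeModel.exists_thinning (T : TreeModel.{u}) (F : Set GMLFormula) (g : ℕ) :
    ∃ K : T.W → Set T.W, ∀ w, (∀ c ∈ K w, T.R w c) ∧
      ∀ τ, {c | c ∈ K w ∧ T.truths F c = τ} ⊆ T.childClass F w τ ∧
        {c | c ∈ K w ∧ T.truths F c = τ}.encard = min (g : ℕ∞) (T.childClass F w τ).encard := by
  have h : ∀ w τ, ∃ C ⊆ T.childClass F w τ, C.encard = min (g : ℕ∞) (T.childClass F w τ).encard :=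
    fun w τ => Set.exists_subset_encard_eq (min_le_right _ _)
  choose C hC hCcard using h
  refine ⟨fun w => {c | c ∈ C w (T.truths F c)}, fun w => ⟨fun c hc => (hC _ _ hc).1, fun τ => ?_⟩⟩
  have e : {c | c ∈ {c | c ∈ C w (T.truths F c)} ∧ T.truths F c = τ} = C w τ := by
    ext c
    constructor
    · rintro ⟨h, rfl⟩
      exact h
    · intro h
      have h' := (hC _ _ h).2
      exact ⟨by rw [← h'] at h; exact h, h'⟩
  rw [e]
  exact ⟨hC w τ, hCcard w τ⟩

/-- The nodes up to depth `j` below `n` are in the letter `0`; the nodes at depth `j` have, if they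
have a child outside the letter `0` in some class with respect to `F`, at least `g` children inside
the letter `0` in this class; below depth `j`, the letter `0` is hereditary for `g` steps. The
formulas in `F` are read with all letters shifted by one. -/
def Retains (F : Set GMLFormula) (g : ℕ) : ℕ → Query.{u}
  | 0 => fun U w => w ∈ U.V 0 ∧
      (∀ τ ∈ 𝒫 F, (1 : ℕ) ≤
          Set.encard {c | U.R w c ∧ c ∉ U.V 0 ∧ (U.rename Nat.succ).truths F c = τ} →
        (g : ℕ∞) ≤ Set.encard {c | U.R w c ∧ c ∈ U.V 0 ∧ (U.rename Nat.succ).truths F c = τ}) ∧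
      ∀ c, U.R w c → c ∈ U.V 0 → ∀ i ∈ Set.Iic g, ∀ x, U.Level i c x → x ∈ U.V 0
  | j + 1 => fun U w => w ∈ U.V 0 ∧ ∀ c, U.R w c → Retains F g j U c

theorem Retains.mono {F : Set GMLFormula} {g g' j : ℕ} (hg : g' ≤ g) {U : TreeModel.{u}} {w : U.W}
    (h : Retains F g j U w) : Retains F g' j U w := by
  induction j generalizing w with
  | zero =>
    refine ⟨h.1, fun τ hτ h1 => le_trans (by exact_mod_cast hg) (h.2.1 τ hτ h1),
      fun c hwc hc i hi => h.2.2 c hwc hc i (le_trans hi hg)⟩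
  | succ j ih => exact ⟨h.1, fun c hc => ih (h.2 c hc)⟩

theorem Retains.mem {F : Set GMLFormula} {g j : ℕ} {U : TreeModel.{u}} {w : U.W}
    (h : Retains F g j U w) : w ∈ U.V 0 := by
  cases j <;> exact h.1

theorem TreeModel.truths_subtree {U : TreeModel.{u}} {n : U.W} {p : PropLetter} (hn : n ∈ U.V p)
    (ρ : PropLetter → PropLetter) (F : Set GMLFormula) (c : (U.subtree n p).W)
    (hc : ∀ x, ReflTransGen U.R c.1 x → x ∈ U.V p) :
    ((U.subtree n p).rename ρ).truths F c = (U.rename ρ).truths F c.1 :=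
  TreeModel.truths_eq_iff.2 fun α _ => TreeModel.sat_subtree_iff hn ρ α c hc

/-- In a countable tree, removing an unlimited amount of redundant children gives a similar tree. -/
theorem similar_subtree_of_retains {F : Set GMLFormula} {m j : ℕ} {U : TreeModel.{u}}
    [Countable U.W] {n : U.W} (hn : n ∈ U.V 0) (w : (U.subtree n 0).W)
    (h : ∀ g, Retains F g j U w.1) :
    Similar F m (j + 1) (U.rename Nat.succ) w.1 ((U.subtree n 0).rename Nat.succ) w := by
  induction j generalizing w with
  | zero =>
    have hdown : ∀ c, U.R w.1 c → c ∈ U.V 0 → ∀ x, ReflTransGen U.R c x → x ∈ U.V 0 := by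
      intro c hwc hc x hx
      obtain ⟨i, hi⟩ := TreeModel.exists_level hx
      exact (h i).2.2 c hwc hc i (Set.mem_Iic.2 le_rfl) x hi
    -- A class that loses a child keeps at least g members for every g, hence infinitely many.
    obtain ⟨e, he⟩ := exists_equiv_of_fibers (A := fun c => U.R w.1 c)
      (B := fun c => U.R w.1 c ∧ c ∈ U.V 0) (fun c => (U.rename Nat.succ).truths F c)
      (fun c => (U.rename Nat.succ).truths F c) (fun τ => by
        refine nonempty_equiv_of_forall_le_encard (fun c hc => ⟨hc.1.1, hc.2⟩) ?_
        rintro ⟨c, ⟨hc1, hc2⟩, hc3⟩ g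
        have hg := (h g).2.1 τ (hc2 ▸ fun α hα => hα.1)
          (Set.one_le_encard_iff_nonempty.2 ⟨c, hc1, fun h0 => hc3 ⟨⟨hc1, h0⟩, hc2⟩, hc2⟩)
        simpa only [and_assoc] using hg)
    refine ⟨fun i _ => Iff.rfl, e.trans (U.subtreeChildren hn w).symm, fun c => ?_⟩
    exact (he c).symm.trans (TreeModel.truths_subtree hn Nat.succ F
      ((U.subtreeChildren hn w).symm (e c)).1 (hdown _ (e c).2.1 (e c).2.2)).symm
  | succ j ih =>
    refine ⟨fun i _ => Iff.rfl, Equiv.trans (Equiv.subtypeEquivRight fun c => ?_)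
      (U.subtreeChildren hn w).symm, fun c => ?_⟩
    · exact ⟨fun hc => ⟨hc, ((h 0).2 c hc).mem⟩, fun hc => hc.1⟩
    · exact ih ((U.subtreeChildren hn w).symm ⟨c.1, c.2, ((h 0).2 c.1 c.2).mem⟩).1
        fun g => (h g).2 c.1 c.2

/-- The letters below `m`, and formulas that count, up to `g`, the children in every class with
respect to `F`; the formula `χ τ` defines the class `τ`. -/
def countingFormulas (F : Set GMLFormula) (χ : Set GMLFormula → GMLFormula) (m g : ℕ) :
    Set GMLFormula :=
  lettersBelow m ∪ Set.image2 (fun i τ => .dia i (χ τ)) (Set.Iic g) (𝒫 F)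

theorem countingFormulas_finite {F : Set GMLFormula} (hF : F.Finite)
    (χ : Set GMLFormula → GMLFormula) (m g : ℕ) : (countingFormulas F χ m g).Finite :=
  (lettersBelow_finite m).union ((Set.finite_Iic g).image2 _ hF.finite_subsets)

/-- The counting formulas decide every threshold up to g for the classes τ ⊆ F; all other classes
are empty. -/
theorem min_encard_childClass_eq {F : Set GMLFormula} {χ : Set GMLFormula → GMLFormula}
    (hχ : ∀ τ (T : TreeModel.{u}) (w : T.W), (χ τ).Sat T w ↔ T.truths F w = τ) {m g : ℕ}
    {T T' : TreeModel.{u}} {w : T.W} {w' : T'.W}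
    (h : T.truths (countingFormulas F χ m g) w = T'.truths (countingFormulas F χ m g) w')
    (τ : Set GMLFormula) :
    min (g : ℕ∞) (T.childClass F w τ).encard = min (g : ℕ∞) (T'.childClass F w' τ).encard := by
  by_cases hτ : τ ⊆ F
  · have key : ∀ i ≤ g, (i : ℕ∞) ≤ (T.childClass F w τ).encard ↔
        (i : ℕ∞) ≤ (T'.childClass F w' τ).encard := by
      intro i hi
      have := TreeModel.truths_eq_iff.1 h (.dia i (χ τ)) (.inr ⟨i, hi, τ, hτ, rfl⟩)
      simp only [GMLFormula.Sat, hχ] at this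
      exact this
    refine le_antisymm ?_ ?_ <;> refine ENat.forall_natCast_le_iff_le.1 fun i hi => ?_
    · rw [le_min_iff] at hi ⊢
      exact ⟨hi.1, (key i (by exact_mod_cast hi.1)).1 hi.2⟩
    · rw [le_min_iff] at hi ⊢
      exact ⟨hi.1, (key i (by exact_mod_cast hi.1)).2 hi.2⟩
  · have : ∀ (T : TreeModel.{u}) (w : T.W), T.childClass F w τ = ∅ := fun T w =>
      Set.eq_empty_of_forall_notMem fun c hc => hτ (hc.2 ▸ fun α hα => hα.1)
    rw [this, this]
    simp

/-- The tree `T` in the letters from `1` on; the letter `0` omits the nodes below `n` that lie below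
a child, not in `K`, of a node at depth `j`. -/
def TreeModel.thin (T : TreeModel.{u}) (K : T.W → Set T.W) (j : ℕ) (n : T.W) : TreeModel.{u} :=
  T.withValuation fun
    | 0 => {x | ∀ w y, T.Level j n w → T.R w y → ReflTransGen T.R y x → y ∈ K w}
    | i + 1 => T.V i

section

variable {T : TreeModel.{u}} {K : T.W → Set T.W} {j : ℕ} {n : T.W}

theorem TreeModel.mem_thin_of_level {i : ℕ} (hi : i ≤ j) {x : T.W} (hx : T.Level i n x) :
    x ∈ (T.thin K j n).V 0 := by
  intro w y hw hwy hyx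
  obtain ⟨l, hl⟩ := exists_level hyx
  have := hx.unique ((hw.trans (level_one hwy)).trans hl)
  omega

/-- The ancestors of x at depths j and j + 1 below n are unique, so the universal condition defining
the letter 0 has a single instance. -/
theorem TreeModel.mem_thin_below {w c x : T.W} (hw : T.Level j n w) (hwc : T.R w c)
    (hcx : ReflTransGen T.R c x) : x ∈ (T.thin K j n).V 0 ↔ c ∈ K w := by
  refine ⟨fun h => h w c hw hwc hcx, fun h w' y hw' hwy hyx => ?_⟩
  obtain ⟨l, hl⟩ := exists_level hcx
  obtain ⟨l', hl'⟩ := exists_level hyx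
  obtain rfl : l = l' := by
    have := ((hw.trans (level_one hwc)).trans hl).unique ((hw'.trans (level_one hwy)).trans hl')
    omega
  obtain rfl := hl.source_unique hl'
  obtain rfl := T.parent_unique hwc hwy
  exact h

/-- If fewer than g members of a class survive, then the minimum with g is the size of the class, so
nothing was removed from it. -/
theorem TreeModel.retains_thin {F : Set GMLFormula} {g : ℕ}
    (hK : ∀ w τ, {c | c ∈ K w ∧ T.truths F c = τ} ⊆ T.childClass F w τ ∧
        {c | c ∈ K w ∧ T.truths F c = τ}.encard = min (g : ℕ∞) (T.childClass F w τ).encard)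
    {i d : ℕ} (hid : i + d = j) {w : T.W} (hw : T.Level i n w) :
    Retains F g d (T.thin K j n) w := by
  induction d generalizing i w with
  | zero =>
    obtain rfl : i = j := hid
    have hmem : ∀ c, T.R w c → (c ∈ (T.thin K i n).V 0 ↔ c ∈ K w) := fun c hc =>
      mem_thin_below hw hc .refl
    have hge : ∀ {τ} c, T.R w c → T.truths F c = τ → c ∉ K w →
        (g : ℕ∞) ≤ {c | c ∈ K w ∧ T.truths F c = τ}.encard := by
      intro τ c hwc hc hcK
      obtain ⟨hsub, hcard⟩ := hK w τ
      by_contra! hlt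
      have hfin : {c | c ∈ K w ∧ T.truths F c = τ}.Finite :=
        Set.encard_lt_top_iff.1 (hlt.trans (ENat.natCast_lt_top g))
      have heq := hfin.eq_of_subset_of_encard_le hsub (by
        rcases min_choice (g : ℕ∞) (T.childClass F w τ).encard with h | h
        · rw [hcard, h] at hlt
          exact absurd hlt (lt_irrefl _)
        · rw [hcard, h])
      have : c ∈ {c | c ∈ K w ∧ T.truths F c = τ} := heq ▸ ⟨hwc, hc⟩
      exact hcK this.1
    refine ⟨mem_thin_of_level le_rfl hw, fun τ _ h1 => ?_, fun c hwc hc k _ x hx => ?_⟩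
    · obtain ⟨c, hwc, hc0, hc⟩ := Set.one_le_encard_iff_nonempty.1 (by exact_mod_cast h1)
      have e : {c | (T.thin K i n).R w c ∧ c ∈ (T.thin K i n).V 0 ∧
          ((T.thin K i n).rename Nat.succ).truths F c = τ} =
          {c | c ∈ K w ∧ T.truths F c = τ} := by
        ext c
        constructor
        · rintro ⟨h1, h2, h3⟩
          exact ⟨(hmem c h1).1 h2, h3⟩
        · intro h
          have h' := (hK w τ).1 h
          exact ⟨h'.1, (hmem c h'.1).2 h.1, h.2⟩
      exact (hge c hwc hc fun h => hc0 ((hmem c hwc).2 h)).trans_eq (congrArg Set.encard e).symm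
    · exact (mem_thin_below hw hwc (level_withValuation.1 hx).reflTransGen).2 ((hmem c hwc).1 hc)
  | succ d ih =>
    exact ⟨mem_thin_of_level (by omega) hw, fun c hc =>
      ih (i := i + 1) (by omega) (show T.Level (i + 1) n c from ⟨w, hw, hc⟩)⟩

/-- Agreement on the counting formulas equates class sizes up to g. After thinning the sizes are
finite and exactly equal, so the children can be matched class by class and similarity extends one
level deeper. -/
theorem Similar.thin {T' : TreeModel.{u}} {K' : T'.W → Set T'.W} {n' : T'.W} {F : Set GMLFormula}
    {χ : Set GMLFormula → GMLFormula}
    (hχ : ∀ τ (T : TreeModel.{u}) (w : T.W), (χ τ).Sat T w ↔ T.truths F w = τ) {m g : ℕ}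
    (hK : ∀ w, (∀ c ∈ K w, T.R w c) ∧ ∀ τ,
      {c | c ∈ K w ∧ T.truths F c = τ}.encard = min (g : ℕ∞) (T.childClass F w τ).encard)
    (hK' : ∀ w, (∀ c ∈ K' w, T'.R w c) ∧ ∀ τ,
      {c | c ∈ K' w ∧ T'.truths F c = τ}.encard = min (g : ℕ∞) (T'.childClass F w τ).encard)
    {i d : ℕ} (hid : i + d = j) (x : ((T.thin K j n).subtree n 0).W)
    (x' : ((T'.thin K' j n').subtree n' 0).W) (hx : T.Level i n x.1) (hx' : T'.Level i n' x'.1)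
    (h : Similar (countingFormulas F χ m g) m d T x.1 T' x'.1) :
    Similar F m (d + 1) (((T.thin K j n).subtree n 0).rename Nat.succ) x
      (((T'.thin K' j n').subtree n' 0).rename Nat.succ) x' := by
  have hn : n ∈ (T.thin K j n).V 0 := TreeModel.mem_thin_of_level (Nat.zero_le j) rfl
  have hn' : n' ∈ (T'.thin K' j n').V 0 := TreeModel.mem_thin_of_level (Nat.zero_le j) rfl
  refine ⟨fun k hk => h.letter_iff Set.subset_union_left hk, ?_⟩
  induction d generalizing i x x' with
  | zero =>
    obtain rfl : i = j := hid
    obtain ⟨e, he⟩ := exists_equiv_of_fibers (A := fun c => c ∈ K x.1)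
      (B := fun c => c ∈ K' x'.1) (fun c => T.truths F c) (fun c => T'.truths F c) (fun τ =>
        nonempty_equiv_of_encard_eq (k := g) (((hK x.1).2 τ).trans_le (min_le_left _ _)) <|
          ((hK x.1).2 τ).trans <| (min_encard_childClass_eq hχ h τ).trans ((hK' x'.1).2 τ).symm)
    have key : ∀ c, (T.thin K i n).R x.1 c ∧ c ∈ (T.thin K i n).V 0 ↔ c ∈ K x.1 := fun c =>
      ⟨fun h => (TreeModel.mem_thin_below hx h.1 .refl).1 h.2, fun h =>
        ⟨(hK x.1).1 c h, (TreeModel.mem_thin_below hx ((hK x.1).1 c h) .refl).2 h⟩⟩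
    have key' : ∀ c, (T'.thin K' i n').R x'.1 c ∧ c ∈ (T'.thin K' i n').V 0 ↔ c ∈ K' x'.1 :=
      fun c => ⟨fun h => (TreeModel.mem_thin_below hx' h.1 .refl).1 h.2, fun h =>
        ⟨(hK' x'.1).1 c h, (TreeModel.mem_thin_below hx' ((hK' x'.1).1 c h) .refl).2 h⟩⟩
    let e₁ := (TreeModel.subtreeChildren _ hn x).trans (Equiv.subtypeEquivRight key)
    let e₂ := (TreeModel.subtreeChildren _ hn' x').trans (Equiv.subtypeEquivRight key')
    refine ⟨e₁.trans (e.trans e₂.symm), fun c => ?_⟩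
    have h1 := TreeModel.truths_subtree hn Nat.succ F c.1 fun y hy =>
      (TreeModel.mem_thin_below hx c.2 hy).2 (e₁ c).2
    have h2 := TreeModel.truths_subtree hn' Nat.succ F (e₂.symm (e (e₁ c))).1 fun y hy =>
      (TreeModel.mem_thin_below hx' (e₂.symm (e (e₁ c))).2 hy).2 (e (e₁ c)).2
    exact h1.trans ((he (e₁ c)).symm.trans h2.symm)
  | succ d ih =>
    obtain ⟨-, e, he⟩ := h
    have key : ∀ c, (T.thin K j n).R x.1 c ∧ c ∈ (T.thin K j n).V 0 ↔ T.R x.1 c := fun c =>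
      ⟨fun h => h.1, fun h => ⟨h, TreeModel.mem_thin_of_level (i := i + 1) (by omega) ⟨_, hx, h⟩⟩⟩
    have key' : ∀ c, (T'.thin K' j n').R x'.1 c ∧ c ∈ (T'.thin K' j n').V 0 ↔ T'.R x'.1 c :=
      fun c => ⟨fun h => h.1, fun h =>
        ⟨h, TreeModel.mem_thin_of_level (i := i + 1) (by omega) ⟨_, hx', h⟩⟩⟩
    let e₁ := (TreeModel.subtreeChildren _ hn x).trans (Equiv.subtypeEquivRight key)
    let e₂ := (TreeModel.subtreeChildren _ hn' x').trans (Equiv.subtypeEquivRight key')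
    refine ⟨e₁.trans (e.trans e₂.symm), fun c => ?_⟩
    refine ⟨fun k hk => (he (e₁ c)).letter_iff Set.subset_union_left hk, ?_⟩
    exact ih (i := i + 1) (by omega) c.1 (e₂.symm (e (e₁ c))).1 ⟨_, hx, c.2⟩
      ⟨_, hx', (e (e₁ c)).2⟩ (he (e₁ c))

end

namespace TreeLogic.IsModalExtension

variable {L : TreeLogic.{u, v}} (hL : L.IsModalExtension)
include hL

theorem definable_retains {F : Set GMLFormula} (hF : F.Finite) (g j : ℕ) :
    L.Definable (Retains F g j) := by
  induction j with
  | zero =>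
    have h0 := hL.definable_letter 0
    have hτ : ∀ τ, L.Definable fun U c => (U.rename Nat.succ).truths F c = τ := by
      intro τ
      obtain ⟨χ, hχ⟩ := GMLFormula.exists_truths_eq.{u} hF τ
      obtain ⟨φ, hφ⟩ := hL.definable_rename (hL.definable_gml χ) Nat.succ
      exact ⟨φ, fun U c => (hφ U c).trans (hχ _ _)⟩
    exact hL.definable_and h0 <| hL.definable_and
      (hL.definable_forall_mem hF.finite_subsets fun τ _ => hL.definable_imp
        (hL.definable_dia (hL.definable_and (hL.definable_not h0) (hτ τ)) 1)
        (hL.definable_dia (hL.definable_and h0 (hτ τ)) g)) <|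
      hL.definable_box <| hL.definable_imp h0 <| hL.definable_forall_mem (Set.finite_Iic g)
        fun i _ => hL.definable_forall_level h0 i
  | succ j ih => exact hL.definable_and (hL.definable_letter 0) (hL.definable_box ih)

/-- With compactness and the Löwenheim–Skolem property, definable properties do not change when
sufficiently redundant children are removed. -/
theorem exists_retains_iff (hc : L.Compactness) (hls : L.LowenheimSkolem) {Q : Query.{u}}
    (hQ : L.Definable Q) {F : Set GMLFormula} (hF : F.Finite) {m j : ℕ}
    (h : ∀ (T : TreeModel.{u}) (n : T.W) (T' : TreeModel.{u}) (n' : T'.W),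
      Similar F m (j + 1) T n T' n' → (Q T n ↔ Q T' n')) :
    ∃ g, ∀ (U : TreeModel.{u}) (n : U.W), Retains F g j U n →
      (Q (U.rename Nat.succ) n ↔ Q ((U.subtree n 0).rename Nat.succ) (U.subtreePoint n 0)) := by
  by_contra! hcon
  let P : ℕ → Query.{u} := fun g U n => Retains F g j U n ∧ ¬ (Q (U.rename Nat.succ) n ↔
    n ∈ U.V 0 ∧ Q ((U.subtree n 0).rename Nat.succ) (U.subtreePoint n 0))
  have hP : ∀ g, L.Definable (P g) := fun g =>
    hL.definable_and (hL.definable_retains hF g j) <| hL.definable_not <|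
      hL.definable_iff (hL.definable_rename hQ _) (hL.definable_subtree (hL.definable_rename hQ _) 0)
  obtain ⟨Γ, hΓs, hΓ⟩ := hc.exists_forall hP fun N => by
    obtain ⟨U, n, hU, hne⟩ := hcon N
    refine ⟨U, n, fun g hg => ⟨hU.mono hg, ?_⟩⟩
    rw [and_iff_right hU.mem]
    tauto
  -- Compactness alone leaves infinite classes that may shrink in cardinality; in a countable model
  -- they cannot.
  obtain ⟨U, n, _, hU⟩ := hls Γ hΓs
  have hall := hΓ U n hU
  have hn := (hall 0).1.mem
  refine (hall 0).2 ?_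
  rw [and_iff_right hn]
  exact h _ _ _ _ (similar_subtree_of_retains hn (U.subtreePoint n 0) fun g => (hall g).1)

/-- Thinning both trees is invisible to Q, and the thinned trees are similar one level deeper than
the original ones. One level of depth is thus paid for by a finite set of counting formulas. -/
theorem exists_similar_pred (hc : L.Compactness) (hls : L.LowenheimSkolem) {Q : Query.{u}}
    (hQ : L.Definable Q) {F : Set GMLFormula} (hF : F.Finite) {m j : ℕ}
    (h : ∀ (T : TreeModel.{u}) (n : T.W) (T' : TreeModel.{u}) (n' : T'.W),
      Similar F m (j + 1) T n T' n' → (Q T n ↔ Q T' n')) :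
    ∃ F' : Set GMLFormula, F'.Finite ∧ ∀ (T : TreeModel.{u}) (n : T.W) (T' : TreeModel.{u})
      (n' : T'.W), Similar F' m j T n T' n' → (Q T n ↔ Q T' n') := by
  obtain ⟨g, hg⟩ := hL.exists_retains_iff hc hls hQ hF h
  choose χ hχ using GMLFormula.exists_truths_eq.{u} hF
  refine ⟨_, countingFormulas_finite hF χ m g, fun T n T' n' hs => ?_⟩
  have key : ∀ (T : TreeModel.{u}) (n : T.W), ∃ K : T.W → Set T.W,
      (∀ w, (∀ c ∈ K w, T.R w c) ∧ ∀ τ,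
        {c | c ∈ K w ∧ T.truths F c = τ}.encard = min (g : ℕ∞) (T.childClass F w τ).encard) ∧
      (Q T n ↔ Q (((T.thin K j n).subtree n 0).rename Nat.succ)
        ((T.thin K j n).subtreePoint n 0)) := by
    intro T n
    obtain ⟨K, hK⟩ := T.exists_thinning F g
    refine ⟨K, fun w => ⟨(hK w).1, fun τ => ((hK w).2 τ).2⟩, ?_⟩
    exact hg (T.thin K j n) n (TreeModel.retains_thin (fun w => (hK w).2) (Nat.zero_add j) rfl)
  obtain ⟨K, hK, hQK⟩ := key T n
  obtain ⟨K', hK', hQK'⟩ := key T' n'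
  rw [hQK, hQK']
  exact h _ _ _ _ (Similar.thin hχ hK hK' (Nat.zero_add j)
    ((T.thin K j n).subtreePoint n 0) ((T'.thin K' j n').subtreePoint n' 0) rfl rfl hs)

/-- With compactness and the Löwenheim–Skolem property, every definable property is determined by
finitely many graded modal formulas. -/
theorem exists_finite_truths (hc : L.Compactness) (hls : L.LowenheimSkolem) {Q : Query.{u}}
    (hQ : L.Definable Q) :
    ∃ F : Set GMLFormula, F.Finite ∧ ∀ (T : TreeModel.{u}) (n : T.W) (T' : TreeModel.{u})
      (n' : T'.W), T.truths F n = T'.truths F n' → (Q T n ↔ Q T' n') := by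
  obtain ⟨m, k, hk⟩ := hL.exists_similar_lettersBelow hc hQ
  have key : ∀ (j : ℕ) (F : Set GMLFormula), F.Finite →
      (∀ (T : TreeModel.{u}) (n : T.W) (T' : TreeModel.{u}) (n' : T'.W),
        Similar F m j T n T' n' → (Q T n ↔ Q T' n')) →
      ∃ F : Set GMLFormula, F.Finite ∧ ∀ (T : TreeModel.{u}) (n : T.W) (T' : TreeModel.{u})
        (n' : T'.W), Similar F m 0 T n T' n' → (Q T n ↔ Q T' n') := by
    intro j
    induction j with
    | zero => exact fun F hF h => ⟨F, hF, h⟩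
    | succ j ih =>
      intro F hF h
      obtain ⟨F', hF', h'⟩ := hL.exists_similar_pred hc hls hQ hF h
      exact ih F' hF' h'
  exact key k _ (lettersBelow_finite m) hk

theorem containedIn_gml (hc : L.Compactness) (hls : L.LowenheimSkolem) :
    L.ContainedIn GML.{u} := by
  have h : ∀ φ : L.Fml, ∃ α : GMLFormula, ∀ (T : TreeModel.{u}) (n : T.W),
      L.Sat φ T n ↔ α.Sat T n := by
    intro φ
    obtain ⟨F, hF, h⟩ := hL.exists_finite_truths hc hls (Q := L.Sat φ) ⟨φ, fun _ _ => Iff.rfl⟩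
    choose χ hχ using GMLFormula.exists_truths_eq.{u} hF
    -- The types over F realised by some model of φ; there are finitely many, and φ is the
    -- disjunction of the formulas defining them.
    let S : Set (Set GMLFormula) :=
      {τ | τ ⊆ F ∧ ∃ (T : TreeModel.{u}) (n : T.W), L.Sat φ T n ∧ T.truths F n = τ}
    obtain ⟨α, hα⟩ := GMLFormula.exists_disj.{u} (hF.finite_subsets.subset
      (fun τ hτ => hτ.1 : S ⊆ {τ | τ ⊆ F})) χ
    refine ⟨α, fun T n => ?_⟩
    rw [hα]
    constructor
    · exact fun hφ => ⟨_, ⟨fun β hβ => hβ.1, T, n, hφ, rfl⟩, (hχ _ T n).2 rfl⟩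
    · rintro ⟨τ, ⟨-, T', n', hφ, rfl⟩, hτ⟩
      exact (h T n T' n' ((hχ _ T n).1 hτ)).2 hφ
  choose f hf using h
  exact ⟨f, hf⟩

end TreeLogic.IsModalExtension

end GMLTrees

/-! ### Löwenheim–Skolem and Compactness for graded modal logic -/

namespace GMLTrees

open Relation Filter

namespace GMLFormula

/-- An injective numbering of the formulas. -/
def code : GMLFormula → ℕ
  | letter p => Nat.pair 0 p
  | bot => Nat.pair 1 0
  | neg φ => Nat.pair 2 φ.code
  | and φ ψ => Nat.pair 3 (Nat.pair φ.code ψ.code)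
  | dia k φ => Nat.pair 4 (Nat.pair k φ.code)

theorem code_injective : Function.Injective code := by
  intro φ
  induction φ with
  | letter p => intro ψ h; cases ψ <;> simp_all [code, Nat.pair_eq_pair]
  | bot => intro ψ h; cases ψ <;> simp_all [code, Nat.pair_eq_pair]
  | neg φ ih =>
    intro ψ h
    cases ψ with
    | neg ψ => rw [ih (Nat.pair_eq_pair.1 h).2]
    | _ => simp [code, Nat.pair_eq_pair] at h
  | and φ χ ih ih' =>
    intro ψ h
    cases ψ with
    | and ψ ψ' =>
      obtain ⟨h1, h2⟩ := Nat.pair_eq_pair.1 (Nat.pair_eq_pair.1 h).2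
      rw [ih h1, ih' h2]
    | _ => simp [code, Nat.pair_eq_pair] at h
  | dia k φ ih =>
    intro ψ h
    cases ψ with
    | dia k' ψ =>
      obtain ⟨h1, h2⟩ := Nat.pair_eq_pair.1 (Nat.pair_eq_pair.1 h).2
      rw [h1, ih h2]
    | _ => simp [code, Nat.pair_eq_pair] at h

instance : Countable GMLFormula := code_injective.countable

end GMLFormula

/-- Listing k distinct witnesses makes the count a finite condition, which passes through an
ultraproduct. -/
theorem natCast_le_encard_iff {α : Type*} {A : Set α} {k : ℕ} :
    (k : ℕ∞) ≤ A.encard ↔ ∃ f : Fin k → α, Function.Injective f ∧ ∀ i, f i ∈ A := by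
  constructor
  · intro h
    obtain ⟨B, hBA, hB⟩ := Set.exists_subset_encard_eq h
    have hfin : B.Finite := Set.finite_of_encard_eq_coe hB
    have := hfin.to_subtype
    have hcard : Nat.card B = k := by
      rw [Nat.card_coe_set_eq, Set.ncard_def, hB, ENat.toNat_natCast]
    let e := (Finite.equivFinOfCardEq hcard).symm
    exact ⟨fun i => (e i).1, Subtype.val_injective.comp e.injective, fun i => hBA (e i).2⟩
  · rintro ⟨f, hf, hfA⟩
    calc (k : ℕ∞) = (Set.univ : Set (Fin k)).encard := by simp
      _ = (f '' Set.univ).encard := (hf.encard_image _).symm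
      _ ≤ A.encard := Set.encard_le_encard (by rintro _ ⟨i, -, rfl⟩; exact hfA i)

/-- The nodes that can be reached from `n` along witnesses chosen by `C`. -/
def hull {W : Type*} (C : W → GMLFormula → ℕ → Set W) (n : W) : ℕ → Set W
  | 0 => {n}
  | i + 1 => ⋃ w ∈ hull C n i, ⋃ α, ⋃ k, C w α k

/-- Close n under up to k witnessing children for each formula and each k. As there are countably
many formulas, the result is a countable subtree with root n, and it keeps enough witnesses for
every graded modality. -/
theorem gml_lowenheimSkolem : GML.{u}.LowenheimSkolem := by
  rintro Γ ⟨T, n, hT⟩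
  have hC : ∀ w α (k : ℕ), ∃ C ⊆ {m | T.R w m ∧ GMLFormula.Sat T α m},
      C.encard = min (k : ℕ∞) {m | T.R w m ∧ GMLFormula.Sat T α m}.encard := fun w α k =>
    Set.exists_subset_encard_eq (min_le_right _ _)
  choose C hC hCcard using hC
  let H : Set T.W := ⋃ i, hull C n i
  have hcount : ∀ i, (hull C n i).Countable := by
    intro i
    induction i with
    | zero => exact Set.countable_singleton n
    | succ i ih =>
      refine ih.biUnion fun w _ => Set.countable_iUnion fun α => Set.countable_iUnion fun k => ?_
      refine (Set.encard_lt_top_iff.1 ?_).countable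
      rw [hCcard]
      exact (min_le_left _ _).trans_lt (ENat.natCast_lt_top k)
  have hH : ∀ w ∈ H, ∀ α k, C w α k ⊆ H := by
    intro w hw α k c hc
    obtain ⟨i, hi⟩ := Set.mem_iUnion.1 hw
    refine Set.mem_iUnion.2 ⟨i + 1, ?_⟩
    simp only [hull, Set.mem_iUnion]
    exact ⟨w, hi, α, k, hc⟩
  have hnH : n ∈ H := Set.mem_iUnion.2 ⟨0, rfl⟩
  have hreach : ∀ i x (hx : x ∈ hull C n i),
      ReflTransGen (fun x y : H => T.R x y) ⟨n, hnH⟩ ⟨x, Set.mem_iUnion.2 ⟨i, hx⟩⟩ := by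
    intro i
    induction i with
    | zero =>
      intro x hx
      obtain rfl : x = n := hx
      exact .refl
    | succ i ih =>
      intro x hx
      have hx' := hx
      simp only [hull, Set.mem_iUnion] at hx'
      obtain ⟨w, hw, α, k, hc⟩ := hx'
      exact (ih w hw).tail (hC w α k hc).1
  have htree : IsTree fun x y : H => T.R x y := by
    have hr : ∀ x : H, ReflTransGen (fun x y : H => T.R x y) ⟨n, hnH⟩ x := by
      rintro ⟨x, hx⟩
      obtain ⟨i, hi⟩ := Set.mem_iUnion.1 hx
      exact hreach i x hi
    refine ⟨⟨n, hnH⟩, fun x hx => ?_, hr, fun x y z hx hy => Subtype.ext (T.parent_unique hx hy)⟩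
    exact T.not_transGen_self n
      (TransGen.tail' ((hr x).lift (p := T.R) Subtype.val fun _ _ h => h) hx)
  have key : ∀ (α : GMLFormula) (x : H), α.Sat (T.restrict H htree) x ↔ α.Sat T x.1 := by
    intro α
    induction α with
    | letter p => exact fun x => Iff.rfl
    | bot => exact fun x => Iff.rfl
    | neg α ih => exact fun x => not_congr (ih x)
    | and α β ihα ihβ => exact fun x => and_congr (ihα x) (ihβ x)
    | dia k α ih =>
      intro x
      have e : Subtype.val '' {m : H | T.R x.1 m.1 ∧ α.Sat (T.restrict H htree) m} =
          {m | T.R x.1 m ∧ α.Sat T m} ∩ H := by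
        ext m
        constructor
        · rintro ⟨m, ⟨h1, h2⟩, rfl⟩
          exact ⟨⟨h1, (ih m).1 h2⟩, m.2⟩
        · rintro ⟨⟨h1, h2⟩, h3⟩
          exact ⟨⟨m, h3⟩, ⟨h1, (ih ⟨m, h3⟩).2 h2⟩, rfl⟩
      have e' : Set.encard {m : H | T.R x.1 m.1 ∧ α.Sat (T.restrict H htree) m} =
          ({m | T.R x.1 m ∧ α.Sat T m} ∩ H).encard := by
        rw [← e, Subtype.val_injective.encard_image]
      change (k : ℕ∞) ≤ Set.encard {m : H | T.R x.1 m.1 ∧ α.Sat (T.restrict H htree) m} ↔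
        (k : ℕ∞) ≤ _
      rw [e']
      refine ⟨fun h => h.trans (Set.encard_le_encard Set.inter_subset_left), fun h => ?_⟩
      have h' : (k : ℕ∞) ≤ (C x.1 α k).encard := by
        rw [hCcard]
        exact le_min le_rfl h
      exact h'.trans (Set.encard_le_encard (Set.subset_inter (hC _ _ _) (hH x.1 x.2 α k)))
  refine ⟨T.restrict H htree, (⟨n, hnH⟩ : H), ?_, fun φ hφ => (key φ _).2 (hT φ hφ)⟩
  exact (Set.countable_iUnion hcount).to_subtype

theorem gml_generated_iff (α : GMLFormula) (T : TreeModel.{u}) (n : T.W) (x : (T.generated n).W) :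
    α.Sat (T.generated n) x ↔ α.Sat T x.1 := by
  induction α generalizing x with
  | letter p => exact Iff.rfl
  | bot => exact Iff.rfl
  | neg α ih => exact not_congr (ih x)
  | and α β ihα ihβ => exact and_congr (ihα x) (ihβ x)
  | dia k α ih =>
    have e : {m | T.R x.1 m ∧ α.Sat T m} = Subtype.val ''
        {m : (T.generated n).W | T.R x.1 m.1 ∧ α.Sat (T.generated n) m} := by
      ext m
      constructor
      · rintro ⟨h1, h2⟩
        have hm : m ∈ T.generatedSet n := ReflTransGen.tail x.2 h1
        exact ⟨⟨m, hm⟩, ⟨h1, (ih ⟨m, hm⟩).2 h2⟩, rfl⟩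
      · rintro ⟨m, ⟨h1, h2⟩, rfl⟩
        exact ⟨h1, (ih m).1 h2⟩
    change _ ↔ (k : ℕ∞) ≤ Set.encard {m | T.R x.1 m ∧ α.Sat T m}
    rw [e, Subtype.val_injective.encard_image]
    exact Iff.rfl

section Ultraproduct

variable {ι : Type} (U : Ultrafilter ι) (T : ι → TreeModel.{u})

/-- The nodes of the ultraproduct of a family of trees. -/
abbrev UltraNode : Type u := (U : Filter ι).Product fun s => (T s).W

variable {U T}

/-- The class of a family of nodes. -/
def UltraNode.mk (f : ∀ s, (T s).W) : UltraNode U T := Quotient.mk _ f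

theorem UltraNode.eq_iff {a b : UltraNode U T} : a = b ↔ ∀ᶠ s in U, a.out s = b.out s :=
  Quotient.out_equiv_out.symm

theorem UltraNode.out_mk (f : ∀ s, (T s).W) : ∀ᶠ s in U, (UltraNode.mk (U := U) f).out s = f s :=
  Quotient.mk_out (s := (U : Filter ι).productSetoid fun s => (T s).W) f

/-- The edge relation of the ultraproduct. -/
def UltraNode.Rel (a b : UltraNode U T) : Prop := ∀ᶠ s in U, (T s).R (a.out s) (b.out s)

/-- The submodel of the ultraproduct of a family of trees that is generated by the class of a family
of roots. -/
def ultraTree (n : ∀ s, (T s).W) (hn : ∀ s x, ¬ (T s).R x (n s)) : TreeModel.{u} where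
  W := {a : UltraNode U T // ReflTransGen UltraNode.Rel (UltraNode.mk n) a}
  R := fun a b => UltraNode.Rel a.1 b.1
  V := fun p => {a | ∀ᶠ s in U, a.1.out s ∈ (T s).V p}
  isTree := by
    refine ⟨⟨_, .refl⟩, fun x hx => ?_, ?_, fun x y z hx hy => ?_⟩
    · obtain ⟨s, h1, h2⟩ := (hx.and (UltraNode.out_mk n)).exists
      exact hn s _ (h2 ▸ h1)
    · rintro ⟨x, hx⟩
      induction hx with
      | refl => exact .refl
      | tail h hbc ih => exact ih.tail hbc
    · refine Subtype.ext (UltraNode.eq_iff.2 ?_)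
      filter_upwards [hx, hy] with s h1 h2
      exact (T s).parent_unique h1 h2

/-- This is Łoś's theorem. Passing to the part reachable from the root is harmless, because the
witnesses for a modality are children and thus stay reachable. -/
theorem sat_ultraTree_iff (n : ∀ s, (T s).W) (hn : ∀ s x, ¬ (T s).R x (n s)) (α : GMLFormula)
    (a : (ultraTree (U := U) n hn).W) :
    α.Sat (ultraTree (U := U) n hn) a ↔ ∀ᶠ s in U, α.Sat (T s) (a.1.out s) := by
  induction α generalizing a with
  | letter p => exact Iff.rfl
  | bot => simp [GMLFormula.Sat, U.neBot.ne]
  | neg α ih => exact (not_congr (ih a)).trans Ultrafilter.eventually_not.symm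
  | and α β ihα ihβ => exact (and_congr (ihα a) (ihβ a)).trans eventually_and.symm
  | dia k α ih =>
    simp only [GMLFormula.Sat, natCast_le_encard_iff]
    constructor
    · rintro ⟨f, hf, hfa⟩
      have h1 : ∀ᶠ s in U, ∀ i, (T s).R (a.1.out s) ((f i).1.out s) ∧
          α.Sat (T s) ((f i).1.out s) :=
        eventually_all.2 fun i => (hfa i).1.and ((ih (f i)).1 (hfa i).2)
      have h2 : ∀ᶠ s in U, ∀ i j, i ≠ j → (f i).1.out s ≠ (f j).1.out s := by
        refine eventually_all.2 fun i => eventually_all.2 fun j => ?_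
        by_cases hij : i = j
        · exact Eventually.of_forall fun s h => absurd hij h
        · refine (Ultrafilter.eventually_not.2 fun h => hij (hf (Subtype.ext ?_))).mono
            fun s h _ => h
          exact UltraNode.eq_iff.2 h
      filter_upwards [h1, h2] with s h1 h2
      exact ⟨fun i => (f i).1.out s, fun i j hij => by_contra fun h => h2 i j h hij, h1⟩
    · intro h
      -- At indices without witnesses the constant value `n s` serves as a default; the ultrafilter
      -- ignores these indices.
      have hex : ∀ s, ∃ f : Fin k → (T s).W,
          (∃ f : Fin k → (T s).W, Function.Injective f ∧
            ∀ i, f i ∈ {m | (T s).R (a.1.out s) m ∧ α.Sat (T s) m}) →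
          Function.Injective f ∧ ∀ i, (T s).R (a.1.out s) (f i) ∧ α.Sat (T s) (f i) := by
        intro s
        by_cases hs : ∃ f : Fin k → (T s).W, Function.Injective f ∧
            ∀ i, f i ∈ {m | (T s).R (a.1.out s) m ∧ α.Sat (T s) m}
        · exact ⟨hs.choose, fun _ => hs.choose_spec⟩
        · exact ⟨fun _ => n s, fun h => absurd h hs⟩
      choose f hf using hex
      have hf' := h.mono hf
      have hmk : ∀ i, ∀ᶠ s in U, (UltraNode.mk (U := U) fun s => f s i).out s = f s i := fun i =>
        UltraNode.out_mk _
      have hR : ∀ i, UltraNode.Rel a.1 (UltraNode.mk fun s => f s i) := fun i => by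
        filter_upwards [hf', hmk i] with s h1 h2
        rw [h2]
        exact (h1.2 i).1
      refine ⟨fun i => ⟨UltraNode.mk fun s => f s i, a.2.tail (hR i)⟩, fun i j hij => ?_,
        fun i => ⟨hR i, (ih _).2 ?_⟩⟩
      · have h3 := UltraNode.eq_iff.1 (congrArg Subtype.val hij)
        obtain ⟨s, h1, h2, h3, h4⟩ := (hf'.and ((hmk i).and ((hmk j).and h3))).exists
        exact h1.1 (h2.symm.trans (h4.trans h3))
      · filter_upwards [hf', hmk i] with s h1 h2
        change α.Sat (T s) ((UltraNode.mk (U := U) fun s => f s i).out s)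
        rw [h2]
        exact (h1.2 i).2

end Ultraproduct

/-- The models of the finite subsets are first replaced by generated submodels, so that their points
are roots and the generated part of the ultraproduct is a tree. -/
theorem gml_compactness : GML.{u}.Compactness := by
  intro Γ hΓ
  have h : ∀ s : Finset GMLFormula, ∃ (T : TreeModel.{u}) (n : T.W), (∀ x, ¬ T.R x n) ∧
      ∀ α ∈ s, α ∈ Γ → α.Sat T n := by
    intro s
    obtain ⟨T, n, hT⟩ := hΓ {α | α ∈ s ∧ α ∈ Γ} (fun α hα => hα.2)
      (s.finite_toSet.subset fun α hα => hα.1)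
    refine ⟨T.generated n, T.generatedPoint n, fun x hx => ?_, fun α hs hα =>
      (gml_generated_iff α T n _).2 (hT α ⟨hs, hα⟩)⟩
    exact T.not_transGen_self n (TransGen.tail' x.2 hx)
  choose T n hn hT using h
  -- Refining `atTop` makes each given formula belong to almost every finite set s.
  let U : Ultrafilter (Finset GMLFormula) := Ultrafilter.of atTop
  refine ⟨ultraTree (U := U) n hn, ⟨UltraNode.mk n, .refl⟩, fun α hα => ?_⟩
  refine (sat_ultraTree_iff n hn α _).2 ?_
  have h1 : ∀ᶠ s in (U : Filter (Finset GMLFormula)), ({α} : Finset GMLFormula) ≤ s :=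
    (eventually_ge_atTop _).filter_mono (Ultrafilter.of_le atTop)
  filter_upwards [h1, UltraNode.out_mk (U := U) n] with s h2 h3
  change α.Sat (T s) ((UltraNode.mk (U := U) n).out s)
  rw [h3]
  exact hT s α (h2 (Finset.mem_singleton_self α)) hα

namespace TreeLogic.ContainedIn

variable {L : TreeLogic.{u, v}} {L' : TreeLogic.{u, w}}

theorem lowenheimSkolem (h : L.ContainedIn L') (h' : L'.LowenheimSkolem) : L.LowenheimSkolem := by
  obtain ⟨f, hf⟩ := h
  rintro Γ ⟨T, n, hT⟩
  obtain ⟨T', n', hc, hT'⟩ := h' (f '' Γ)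
    ⟨T, n, by rintro _ ⟨φ, hφ, rfl⟩; exact (hf φ T n).1 (hT φ hφ)⟩
  exact ⟨T', n', hc, fun φ hφ => (hf φ T' n').2 (hT' _ ⟨φ, hφ, rfl⟩)⟩

theorem compactness (h : L.ContainedIn L') (h' : L'.Compactness) : L.Compactness := by
  classical
  obtain ⟨f, hf⟩ := h
  intro Γ hΓ
  obtain ⟨T, n, hT⟩ := h' (f '' Γ) fun Δ hΔ hfin => by
    lift Δ to Finset L'.Fml using hfin
    obtain ⟨s, hs, rfl⟩ := Finset.subset_set_image_iff.1 hΔ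
    obtain ⟨T, n, hT⟩ := hΓ s hs s.finite_toSet
    refine ⟨T, n, fun ψ hψ => ?_⟩
    obtain ⟨φ, hφ, rfl⟩ := Finset.mem_image.1 (Finset.mem_coe.1 hψ)
    exact (hf φ T n).1 (hT φ hφ)
  exact ⟨T, n, fun φ hφ => (hf φ T n).2 (hT _ ⟨φ, hφ, rfl⟩)⟩

end TreeLogic.ContainedIn

end GMLTrees

theorem mainTheorem11 (L : GMLTrees.TreeLogic.{u, v}) (hL : L.IsAbstractModalLogic)
    (hsubst : L.ClosedUnderSubstitution) (hext : GMLTrees.GML.{u}.ContainedIn L) :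
    (L.Compactness ∧ L.LowenheimSkolem ↔ L.ContainedIn GMLTrees.GML.{u}) ∧
      (L.Compactness ∧ L.LowenheimSkolem → L.GeneratedSubmodelInvariant) := by
  have h : L.IsModalExtension := ⟨hL, hsubst, hext⟩
  refine ⟨⟨fun hc => h.containedIn_gml hc.1 hc.2, fun hc => ?_⟩, fun hc φ T n => ?_⟩
  · exact ⟨hc.compactness GMLTrees.gml_compactness, hc.lowenheimSkolem GMLTrees.gml_lowenheimSkolem⟩
  · exact h.generated_iff hc.1 (Q := L.Sat φ) ⟨φ, fun _ _ => Iff.rfl⟩ T n
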